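/- Let $1<p<\infty$, let $N\ge 1$, let $a_1,\dots,a_N\in\mathbb D\setminus\{0\}$ (repetitions allowed), and let $$J(z)=\prod_{k=1}^N\frac{z-a_k}{1-\overline{a_k}z}.$$ Here $H^p$ is the space of holomorphic $f$ on the unit disk $\mathbb D$ with $\|f\|_p=\sup_{0<r<1}\bigl(\frac1{2\pi}\int_0^{2\pi}|f(re^{i\theta})|^p\,d\theta\bigr)^{1/p}<\infty$, and $[J]_p$ is the closure in $H^p$ of the linear span of $\{z^kJ:k\ge 0\}$. All powers below are principal branches. Then $\inf_{h\in H^p}\|1-Jh\|_p$ is attained by exactly one $h^*\in H^p$, and for $z\in\mathbb D$ $$1-J(z)h^*(z)=\bigl(1-\overline{J(0)}J(z)\bigr)^{2/p}.$$ Moreover, there are an integer $d$ with $0\le d\le N-1$ and $w_1,\dots,w_d\in\overline{\mathbb D}\setminus\{0\}$ such that for all $z\in\mathbb D$ $$1-J(z)h^*(z)=(1-|a_1\cdots a_N|^2)^{2/p}\left[\frac{\prod_{k=1}^d(1-\overline{w_k}z)}{\prod_{k=1}^N(1-\overline{a_k}z)}\right]^{2/p}$$ and $$1=(1-|a_1\cdots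 a_N|^2)\,\frac{\prod_{k=1}^d(1-\overline{w_k}a_j)}{\prod_{k=1}^N(1-\overline{a_k}a_j)}\qquad(1\le j\le N).$$ If the $a_j$ are pairwise distinct, these $N$ conditions determine $d\le N-1$ and the nonzero parameters $w_1,\dots,w_d$ up to order. For $N=1$ the formula reads $$1-J(z)h^*(z)=\left[\frac{1-|a_1|^2}{1-\overline{a_1}z}\right]^{2/p}\qquad(z\in\mathbb D).$$ Finally, $\operatorname{dist}_{H^p}(1,[J]_p)=(1-|J(0)|^2)^{1/p}$. -/

import Mathlib

open scoped ENNReal ComplexConjugate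

noncomputable section

namespace Hardy

/-- The open unit disk. -/
def disk : Set ℂ := Metric.ball 0 1

/-- The Hardy norm `sup_{0<r<1} ((1/2π) ∫_0^{2π} |f(r e^{iθ})|^p dθ)^{1/p}`, with values in `[0, ∞]`.
It depends only on the values of `f` in the open unit disk. -/
def hpNorm (p : ℝ) (f : ℂ → ℂ) : ℝ≥0∞ :=
  ⨆ r ∈ Set.Ioo (0 : ℝ) 1,
    (ENNReal.ofReal (2 * Real.pi)⁻¹ *
      ∫⁻ θ in Set.Ioc 0 (2 * Real.pi), ‖f (circleMap 0 r θ)‖ₑ ^ p) ^ (1 / p)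

/-- `f` restricted to the open unit disk belongs to the Hardy space `H^p`. Functions are taken to be
defined on all of `ℂ`, their values off the disk being irrelevant. -/
def MemHp (p : ℝ) (f : ℂ → ℂ) : Prop :=
  DifferentiableOn ℂ f disk ∧ hpNorm p f < ∞

/-- The forward shift `(S f)(z) = z f(z)`. -/
def shift (f : ℂ → ℂ) : ℂ → ℂ := fun z => z * f z

/-- `[f]_p`: the closure in `H^p` of the linear span of `S^k f`, `k = 0, 1, 2, …`. -/
def invariantSubspace (p : ℝ) (f : ℂ → ℂ) : Set (ℂ → ℂ) :=
  {g | MemHp p g ∧ ∀ ε : ℝ≥0∞, 0 < ε →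
    ∃ u ∈ Submodule.span ℂ (Set.range fun k : ℕ => shift^[k] f), hpNorm p (g - u) < ε}

/-- The distance from `f` to the set `M`, in the `H^p` norm. -/
def hpDist (p : ℝ) (f : ℂ → ℂ) (M : Set (ℂ → ℂ)) : ℝ≥0∞ :=
  ⨅ g ∈ M, hpNorm p (f - g)

/-- The finite Blaschke product with zeros `a_1, …, a_N`. -/
def blaschke {N : ℕ} (a : Fin N → ℂ) (z : ℂ) : ℂ :=
  ∏ k, (z - a k) / (1 - conj (a k) * z)

/-- `h` belongs to `H^p` and attains the infimum of `‖1 - J h‖_p` over `H^p`. -/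
def IsExtremal (p : ℝ) (J h : ℂ → ℂ) : Prop :=
  MemHp p h ∧ hpNorm p (1 - J * h) = ⨅ (g : ℂ → ℂ) (_ : MemHp p g), hpNorm p (1 - J * g)

/-- The constant `1 - |a_1 a_2 ⋯ a_N|^2`. -/
def scale {N : ℕ} (a : Fin N → ℂ) : ℝ := 1 - ‖∏ k, a k‖ ^ 2

/-- The rational function `∏ (1 - conj w_k z) / ∏ (1 - conj a_k z)`. -/
def ratio {N d : ℕ} (a : Fin N → ℂ) (w : Fin d → ℂ) (z : ℂ) : ℂ :=
  (∏ k, (1 - conj (w k) * z)) / ∏ k, (1 - conj (a k) * z)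

/-- The conditions `1 = (1 - |a_1 ⋯ a_N|^2) ∏ (1 - conj w_k a_j) / ∏ (1 - conj a_k a_j)` for all `j`. -/
def Consistent {N d : ℕ} (a : Fin N → ℂ) (w : Fin d → ℂ) : Prop :=
  ∀ j, 1 = (scale a : ℂ) * ratio a w (a j)

end Hardy

end

namespace Hardy

open Real Set MeasureTheory

/-! ### Circle averages and the Hardy norm -/

/-! Put `c = J 0`, `F = 1 - conj c * J` and `G = F ^ (2 / p)`. Since `1 - G` vanishes wherever `J`
does, `G = 1 - J h*` with `h*` holomorphic, and `‖G‖ ^ p = ‖F‖ ^ 2`. On the unit circle `‖J‖ = 1`,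
so `conj F * J = J - c`. Hence the derivative at `h*` of the mean of `‖1 - J g‖ ^ p` in a direction
`u` is, up to sign, `p` times the real part of the mean of `(J - c) (F / G) u`. This function is
holomorphic and vanishes at `0`, so the derivative is zero. Strict convexity makes `h*` the only
minimizer, and the minimum is the mean of `‖F‖ ^ 2`, namely `1 - ‖c‖ ^ 2`.

No boundary values are used. The computation runs on circles of radius `r < 1`, where it fails only
by a multiple of `1 - ‖J‖ ^ 2`, which is `O(1 - r ^ 2)` for a finite Blaschke product. The
first-order bound is `le_norm_add_rpow`, averaged in `exists_circleAverage_bound`; keeping its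
convexity remainder (`gap`) yields uniqueness in `eqOn_extremal`.

For the distance, `h*` extends past the closed disk, so Taylor polynomials approximate it uniformly.
For the product formula, the numerator of `F` has degree below `N` and no zero in the disk; its
zeros are the points `1 / conj (w k)`. -/

lemma mem_disk {z : ℂ} : z ∈ disk ↔ ‖z‖ < 1 := by simp [disk]

lemma sphere_subset_disk {r : ℝ} (hr : r ∈ Ioo (0 : ℝ) 1) : Metric.sphere (0 : ℂ) |r| ⊆ disk := by
  intro z hz
  rw [abs_of_pos hr.1] at hz
  simp only [mem_sphere_iff_norm, sub_zero] at hz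
  rw [mem_disk, hz]
  exact hr.2

lemma circleIntegrable_of_continuousOn_disk {E : Type*} [NormedAddCommGroup E] {f : ℂ → E}
    (hf : ContinuousOn f disk) {r : ℝ} (hr : r ∈ Ioo (0 : ℝ) 1) : CircleIntegrable f 0 r :=
  (hf.mono (abs_of_pos hr.1 ▸ sphere_subset_disk hr)).circleIntegrable hr.1.le

lemma closedBall_subset_disk {r : ℝ} (hr : r ∈ Ioo (0 : ℝ) 1) :
    Metric.closedBall (0 : ℂ) r ⊆ disk := Metric.closedBall_subset_ball hr.2

lemma diffContOnCl_of_differentiableOn_disk {f : ℂ → ℂ} (hf : DifferentiableOn ℂ f disk) {r : ℝ}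
    (hr : r ∈ Ioo (0 : ℝ) 1) : DiffContOnCl ℂ f (Metric.ball 0 |r|) := by
  apply DifferentiableOn.diffContOnCl
  rw [abs_of_pos hr.1, closure_ball _ hr.1.ne']
  exact hf.mono (closedBall_subset_disk hr)

lemma circleAverage_eq_apply_zero {f : ℂ → ℂ} (hf : DifferentiableOn ℂ f disk) {r : ℝ}
    (hr : r ∈ Ioo (0 : ℝ) 1) : circleAverage f 0 r = f 0 :=
  (diffContOnCl_of_differentiableOn_disk hf hr).circleAverage

lemma circleAverage_re_eq {f : ℂ → ℂ} (hf : DifferentiableOn ℂ f disk) {r : ℝ}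
    (hr : r ∈ Ioo (0 : ℝ) 1) : circleAverage (fun z => (f z).re) 0 r = (f 0).re := by
  have := Complex.reCLM.circleAverage_comp_comm
    (circleIntegrable_of_continuousOn_disk hf.continuousOn hr)
  rw [circleAverage_eq_apply_zero hf hr] at this
  exact this

lemma circleAverage_mono_disk {f g : ℂ → ℝ} (hf : ContinuousOn f disk) (hg : ContinuousOn g disk)
    {r : ℝ} (hr : r ∈ Ioo (0 : ℝ) 1) (h : ∀ z ∈ disk, ‖z‖ = r → f z ≤ g z) :
    circleAverage f 0 r ≤ circleAverage g 0 r :=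
  circleAverage_mono (circleIntegrable_of_continuousOn_disk hf hr)
    (circleIntegrable_of_continuousOn_disk hg hr) fun z hz =>
      h z (sphere_subset_disk hr hz) (by simpa [abs_of_pos hr.1] using hz)

lemma circleAverage_add_disk {f g : ℂ → ℝ} (hf : ContinuousOn f disk) (hg : ContinuousOn g disk)
    {r : ℝ} (hr : r ∈ Ioo (0 : ℝ) 1) :
    circleAverage (fun z => f z + g z) 0 r = circleAverage f 0 r + circleAverage g 0 r :=
  circleAverage_fun_add (circleIntegrable_of_continuousOn_disk hf hr)
    (circleIntegrable_of_continuousOn_disk hg hr)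

lemma circleAverage_const_mul (b : ℝ) (f : ℂ → ℝ) (r : ℝ) :
    circleAverage (fun z => b * f z) 0 r = b * circleAverage f 0 r :=
  circleAverage_fun_smul (a := b) (f := f)

/-- Cauchy's formula writes `f w` as the mean of `z / (z - w) * f z`, and this kernel is at most `r
/ (r - ‖w‖)` with `r < 1`. -/
lemma norm_apply_le_circleAverage {f : ℂ → ℂ} (hf : DifferentiableOn ℂ f disk) {r : ℝ}
    (hr : r ∈ Ioo (0 : ℝ) 1) {w : ℂ} (hw : ‖w‖ < r) :
    ‖f w‖ ≤ (r - ‖w‖)⁻¹ * circleAverage (fun z => ‖f z‖) 0 r := by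
  have hd := diffContOnCl_of_differentiableOn_disk hf hr
  rw [← hd.circleAverage_smul_div (w := w) (by simpa [abs_of_pos hr.1] using hw),
    ← circleAverage_const_mul, circleAverage_def, circleAverage_def, norm_smul, smul_eq_mul,
    Real.norm_of_nonneg (by positivity)]
  refine mul_le_mul_of_nonneg_left ?_ (by positivity)
  refine intervalIntegral.norm_integral_le_of_norm_le (by positivity) ?_ ?_
  · refine Filter.Eventually.of_forall fun θ _ => ?_
    rw [norm_smul]
    refine mul_le_mul_of_nonneg_right ?_ (norm_nonneg _)
    have h1 : ‖circleMap 0 r θ‖ = r := by simp [abs_of_pos hr.1]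
    have h2 : r - ‖w‖ ≤ ‖circleMap 0 r θ - w‖ := by
      have := norm_sub_norm_le (circleMap 0 r θ) w
      rwa [h1] at this
    rw [sub_zero, norm_div, h1, div_eq_mul_inv]
    calc r * ‖circleMap 0 r θ - w‖⁻¹ ≤ 1 * (r - ‖w‖)⁻¹ := by
          gcongr
          · exact hr.2.le
      _ = _ := one_mul _
  · exact ((circleIntegrable_of_continuousOn_disk (hf.continuousOn.norm) hr)).const_mul _

lemma continuousOn_norm_rpow {f : ℂ → ℂ} (hf : ContinuousOn f disk) {p : ℝ} (hp : 0 ≤ p) :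
    ContinuousOn (fun z => ‖f z‖ ^ p) disk :=
  hf.norm.rpow_const fun _ _ => Or.inr hp

lemma lintegral_circle_eq {f : ℂ → ℂ} (hf : ContinuousOn f disk) {p : ℝ} (hp : 0 ≤ p) {r : ℝ}
    (hr : r ∈ Ioo (0 : ℝ) 1) :
    ENNReal.ofReal (2 * π)⁻¹ * ∫⁻ θ in Ioc 0 (2 * π), ‖f (circleMap 0 r θ)‖ₑ ^ p =
      ENNReal.ofReal (circleAverage (fun z => ‖f z‖ ^ p) 0 r) := by
  have hi := circleIntegrable_of_continuousOn_disk (continuousOn_norm_rpow hf hp) hr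
  rw [circleAverage_def, smul_eq_mul, ENNReal.ofReal_mul (by positivity),
    intervalIntegral.integral_of_le (by positivity),
    ofReal_integral_eq_lintegral_ofReal]
  · congr 1
    refine lintegral_congr fun θ => ?_
    rw [← ENNReal.ofReal_rpow_of_nonneg (norm_nonneg _) hp, ofReal_norm]
  · exact (intervalIntegrable_iff_integrableOn_Ioc_of_le (by positivity)).1 hi
  · exact Filter.Eventually.of_forall fun θ => by positivity

lemma hpNorm_le_iff {f : ℂ → ℂ} (hf : ContinuousOn f disk) {p : ℝ} (hp : 0 < p) {B : ℝ}
    (hB : 0 ≤ B) :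
    hpNorm p f ≤ ENNReal.ofReal (B ^ (1 / p)) ↔
      ∀ r ∈ Ioo (0 : ℝ) 1, circleAverage (fun z => ‖f z‖ ^ p) 0 r ≤ B := by
  simp only [hpNorm, iSup_le_iff]
  refine forall₂_congr fun r hr => ?_
  rw [lintegral_circle_eq hf hp.le hr, ← ENNReal.ofReal_rpow_of_nonneg hB (by positivity),
    ENNReal.rpow_le_rpow_iff (by positivity), ENNReal.ofReal_le_ofReal_iff hB]

lemma exists_circleAverage_le {f : ℂ → ℂ} (hf : ContinuousOn f disk) {p : ℝ} (hp : 0 < p)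
    (h : hpNorm p f < ∞) :
    ∃ B : ℝ, 0 ≤ B ∧ ∀ r ∈ Ioo (0 : ℝ) 1, circleAverage (fun z => ‖f z‖ ^ p) 0 r ≤ B := by
  refine ⟨(hpNorm p f).toReal ^ p, by positivity, (hpNorm_le_iff hf hp (by positivity)).1 ?_⟩
  rw [← Real.rpow_mul ENNReal.toReal_nonneg, mul_one_div_cancel hp.ne', Real.rpow_one,
    ENNReal.ofReal_toReal h.ne]

lemma hpNorm_le_of_norm_le {f : ℂ → ℂ} (hf : ContinuousOn f disk) {p : ℝ} (hp : 0 < p) {B : ℝ}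
    (hB : 0 ≤ B) (h : ∀ z ∈ disk, ‖f z‖ ≤ B) : hpNorm p f ≤ ENNReal.ofReal B := by
  have h1 : B = (B ^ p) ^ (1 / p) := by
    rw [← Real.rpow_mul hB, mul_one_div_cancel hp.ne', Real.rpow_one]
  rw [h1, hpNorm_le_iff hf hp (by positivity)]
  intro r hr
  calc _ ≤ circleAverage (fun _ => B ^ p) 0 r :=
        circleAverage_mono_disk (continuousOn_norm_rpow hf hp.le) continuousOn_const hr
          fun z hz _ => by have := h z hz; gcongr
    _ = _ := circleAverage_const _ _ _

lemma memHp_of_norm_le {f : ℂ → ℂ} (hf : DifferentiableOn ℂ f disk) {p : ℝ} (hp : 0 < p) {B : ℝ}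
    (hB : 0 ≤ B) (h : ∀ z ∈ disk, ‖f z‖ ≤ B) : MemHp p f :=
  ⟨hf, (hpNorm_le_of_norm_le hf.continuousOn hp hB h).trans_lt ENNReal.ofReal_lt_top⟩

/-- Minkowski's inequality on each circle, with the factor `1 / 2π` absorbed into the measure. -/
lemma hpNorm_add_le {f g : ℂ → ℂ} (hf : ContinuousOn f disk) (hg : ContinuousOn g disk) {p : ℝ}
    (hp : 1 ≤ p) : hpNorm p (f + g) ≤ hpNorm p f + hpNorm p g := by
  have hp0 : 0 < p := by linarith
  refine iSup₂_le fun r hr => ?_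
  have key : ∀ u : ℂ → ℂ, (ENNReal.ofReal (2 * π)⁻¹ *
      ∫⁻ θ in Ioc 0 (2 * π), ‖u (circleMap 0 r θ)‖ₑ ^ p) ^ (1 / p) =
      (∫⁻ θ, ‖u (circleMap 0 r θ)‖ₑ ^ p
        ∂(ENNReal.ofReal (2 * π)⁻¹ • volume.restrict (Ioc 0 (2 * π)))) ^ (1 / p) := fun u => by
    rw [lintegral_smul_measure, smul_eq_mul]
  have meas : ∀ u : ℂ → ℂ, ContinuousOn u disk → AEMeasurable (fun θ => ‖u (circleMap 0 r θ)‖ₑ)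
      (ENNReal.ofReal (2 * π)⁻¹ • volume.restrict (Ioc 0 (2 * π))) := fun u hu => by
    have : Continuous fun θ => u (circleMap 0 r θ) :=
      hu.comp_continuous (continuous_circleMap 0 r) fun θ =>
        sphere_subset_disk hr (circleMap_mem_sphere' 0 r θ)
    exact this.enorm.aemeasurable
  refine le_trans ?_ (add_le_add (le_iSup₂ (f := fun r (_ : r ∈ Ioo (0 : ℝ) 1) =>
    (ENNReal.ofReal (2 * π)⁻¹ * ∫⁻ θ in Ioc 0 (2 * π), ‖f (circleMap 0 r θ)‖ₑ ^ p) ^ (1 / p)) r hr)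
    (le_iSup₂ (f := fun r (_ : r ∈ Ioo (0 : ℝ) 1) =>
    (ENNReal.ofReal (2 * π)⁻¹ * ∫⁻ θ in Ioc 0 (2 * π), ‖g (circleMap 0 r θ)‖ₑ ^ p) ^ (1 / p)) r hr))
  rw [key, key, key]
  refine le_trans ?_ (ENNReal.lintegral_Lp_add_le (meas f hf) (meas g hg) hp)
  gcongr with θ
  exact enorm_add_le _ _

/-! ### The Bregman remainder of `‖x‖ ^ p` at `1` -/

/-- The remainder of the first order expansion of `x ↦ ‖x‖ ^ p` at `x = 1`. -/
noncomputable def remainder (p : ℝ) (x : ℂ) : ℝ := ‖x‖ ^ p - 1 - p * (x - 1).re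

lemma remainder_one (p : ℝ) : remainder p 1 = 0 := by simp [remainder]

/-- Strict Bernoulli combined with `x.re ≤ ‖x‖`. Bernoulli degenerates when `‖x‖ = 1`, but then
`x.re < 1`. -/
lemma remainder_pos {p : ℝ} (hp : 1 < p) {x : ℂ} (hx : x ≠ 1) : 0 < remainder p x := by
  have h1 := Complex.re_le_norm x
  simp only [remainder, Complex.sub_re, Complex.one_re]
  by_cases h : ‖x‖ = 1
  · have h2 : x.re ≠ 1 := fun h2 => hx <| by
      have h3 : ‖x‖ ^ 2 = x.re * x.re + x.im * x.im := by
        rw [Complex.sq_norm, Complex.normSq_apply]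
      rw [h, h2] at h3
      have h4 : x.im = 0 := by nlinarith
      exact Complex.ext h2 h4
    have h3 : x.re < 1 := lt_of_le_of_ne (h ▸ h1) h2
    rw [h, Real.one_rpow]
    nlinarith
  · have := one_add_mul_self_lt_rpow_one_add (s := ‖x‖ - 1) (by linarith [norm_nonneg x])
      (sub_ne_zero.2 h) hp
    rw [add_sub_cancel] at this
    nlinarith

lemma remainder_nonneg {p : ℝ} (hp : 1 < p) (x : ℂ) : 0 ≤ remainder p x := by
  by_cases h : x = 1
  · rw [h, remainder_one]
  · exact (remainder_pos hp h).le

lemma continuous_remainder {p : ℝ} (hp : 0 ≤ p) : Continuous (remainder p) := by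
  have : Continuous fun x : ℂ => ‖x‖ ^ p := continuous_norm.rpow_const fun _ => Or.inr hp
  unfold remainder
  fun_prop

lemma remainder_segment_le {p : ℝ} (hp : 1 ≤ p) (x : ℂ) {s : ℝ} (hs : 0 ≤ s) (hs1 : s ≤ 1) :
    remainder p (1 + s * (x - 1)) ≤ s * remainder p x := by
  have h1 : ‖1 + s * (x - 1)‖ ≤ (1 - s) * 1 + s * ‖x‖ := by
    calc ‖1 + s * (x - 1)‖ = ‖((1 - s : ℝ) : ℂ) + (s : ℂ) * x‖ := by congr 1; push_cast; ring
      _ ≤ ‖((1 - s : ℝ) : ℂ)‖ + ‖(s : ℂ) * x‖ := norm_add_le _ _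
      _ = _ := by
        rw [norm_mul, Complex.norm_real, Complex.norm_real, Real.norm_of_nonneg hs,
          Real.norm_of_nonneg (by linarith), mul_one]
  have h2 := (convexOn_rpow hp).2 (x := 1) (y := ‖x‖) (by simp) (by simp)
    (sub_nonneg.2 hs1) hs (by ring)
  simp only [smul_eq_mul, Real.one_rpow] at h2
  have h3 : ‖1 + s * (x - 1)‖ ^ p ≤ ((1 - s) * 1 + s * ‖x‖) ^ p :=
    Real.rpow_le_rpow (norm_nonneg _) h1 (by linarith)
  simp only [remainder, add_sub_cancel_left, Complex.re_ofReal_mul]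
  nlinarith

/-- The remainder has a positive minimum on the sphere of radius `ε` about `1`, and by convexity it
grows at least linearly along rays beyond it. Points inside the sphere are covered by the term `ε`.
-/
lemma exists_norm_sub_one_le {p : ℝ} (hp : 1 < p) {ε : ℝ} (hε : 0 < ε) :
    ∃ C : ℝ, 0 ≤ C ∧ ∀ x : ℂ, ‖x - 1‖ ≤ ε + C * remainder p x := by
  obtain ⟨x₀, hx₀, hmin⟩ := (isCompact_sphere (1 : ℂ) ε).exists_isMinOn
    (NormedSpace.sphere_nonempty.2 hε.le) (continuous_remainder (p := p) (by linarith)).continuousOn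
  have hm : 0 < remainder p x₀ := remainder_pos hp fun h => by
    simp [h] at hx₀; linarith
  refine ⟨ε / remainder p x₀, by positivity, fun x => ?_⟩
  have hx := remainder_nonneg hp x
  by_cases h : ‖x - 1‖ ≤ ε
  · have : 0 ≤ ε / remainder p x₀ * remainder p x := by positivity
    linarith
  · push Not at h
    have hpos : 0 < ‖x - 1‖ := hε.trans h
    have h1 := remainder_segment_le hp.le x (s := ε / ‖x - 1‖) (by positivity)
      ((div_le_one hpos).2 h.le)
    have h2 : remainder p x₀ ≤ remainder p (1 + ((ε / ‖x - 1‖ : ℝ) : ℂ) * (x - 1)) := by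
      apply hmin
      rw [mem_sphere_iff_norm, add_sub_cancel_left, norm_mul, Complex.norm_real,
        Real.norm_of_nonneg (by positivity), div_mul_cancel₀ _ hpos.ne']
    have h3 : ‖x - 1‖ ≤ ε / remainder p x₀ * remainder p x := by
      rw [div_mul_eq_mul_div, le_div_iff₀ hm]
      have h4 := h2.trans h1
      rw [div_mul_eq_mul_div, le_div_iff₀ hpos] at h4
      linarith
    linarith

/-! ### The extremal function -/

/-- A holomorphic self-map of the disk, not unimodular at `0`, whose modulus tends to `1` at the
boundary at least as fast as `‖z‖`. -/
structure IsRegularInner (J : ℂ → ℂ) : Prop where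
  differentiableOn : DifferentiableOn ℂ J disk
  norm_le_one : ∀ z ∈ disk, ‖J z‖ ≤ 1
  norm_zero_lt_one : ‖J 0‖ < 1
  defect : ∃ C : ℝ, 0 ≤ C ∧ ∀ z ∈ disk, 1 - ‖J z‖ ^ 2 ≤ C * (1 - ‖z‖ ^ 2)

/-- The quotient `(1 - (1 - conj c * w) ^ (2 / p)) / w`, extended to `w = 0`. -/
noncomputable def extremalQuotient (p : ℝ) (c : ℂ) : ℂ → ℂ :=
  dslope (fun w => 1 - (1 - conj c * w) ^ ((2 / p : ℝ) : ℂ)) 0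

/-- The solution `h` of `1 - J h = (1 - conj (J 0) * J) ^ (2 / p)`. -/
noncomputable def extremal (p : ℝ) (J : ℂ → ℂ) (z : ℂ) : ℂ := extremalQuotient p (J 0) (J z)

lemma mul_extremalQuotient (p : ℝ) (c w : ℂ) :
    w * extremalQuotient p c w = 1 - (1 - conj c * w) ^ ((2 / p : ℝ) : ℂ) := by
  have := sub_smul_dslope (fun w => 1 - (1 - conj c * w) ^ ((2 / p : ℝ) : ℂ)) 0 w
  simpa [extremalQuotient] using this

lemma one_sub_mul_extremal (p : ℝ) (J : ℂ → ℂ) (z : ℂ) :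
    1 - J z * extremal p J z = (1 - conj (J 0) * J z) ^ ((2 / p : ℝ) : ℂ) := by
  rw [extremal, mul_extremalQuotient, sub_sub_cancel]

lemma re_one_sub_ge (c w : ℂ) : 1 - ‖c‖ * ‖w‖ ≤ (1 - conj c * w).re := by
  have := Complex.re_le_norm (conj c * w)
  rw [norm_mul, RCLike.norm_conj] at this
  simp only [Complex.sub_re, Complex.one_re]
  linarith

lemma one_sub_mem_slitPlane {c w : ℂ} (h : ‖c‖ * ‖w‖ < 1) : 1 - conj c * w ∈ Complex.slitPlane :=
  Or.inl (lt_of_lt_of_le (by linarith) (re_one_sub_ge c w))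

lemma differentiableOn_one_sub_cpow (s c : ℂ) :
    DifferentiableOn ℂ (fun w => (1 - conj c * w) ^ s) {w | ‖c‖ * ‖w‖ < 1} := by
  intro w hw
  have : DifferentiableAt ℂ (fun w => 1 - conj c * w) w := by fun_prop
  exact (this.cpow_const (one_sub_mem_slitPlane hw)).differentiableWithinAt

/-- Removable singularity at `0`; elsewhere the base of the power stays in the right half-plane. -/
lemma differentiableOn_extremalQuotient (p : ℝ) (c : ℂ) :
    DifferentiableOn ℂ (extremalQuotient p c) {w | ‖c‖ * ‖w‖ < 1} := by
  have ho : IsOpen {w : ℂ | ‖c‖ * ‖w‖ < 1} := isOpen_lt (by fun_prop) (by fun_prop)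
  refine (Complex.differentiableOn_dslope (ho.mem_nhds (by simp))).2 ?_
  exact (differentiableOn_one_sub_cpow _ c).const_sub 1

lemma IsRegularInner.mul_norm_lt_one {J : ℂ → ℂ} (hJ : IsRegularInner J) {z : ℂ} (hz : z ∈ disk) :
    ‖J 0‖ * ‖J z‖ < 1 := by
  have := hJ.norm_le_one z hz
  have := hJ.norm_zero_lt_one
  nlinarith [norm_nonneg (J 0), norm_nonneg (J z)]

lemma IsRegularInner.differentiableOn_extremal {J : ℂ → ℂ} (hJ : IsRegularInner J) (p : ℝ) :
    DifferentiableOn ℂ (extremal p J) disk :=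
  (differentiableOn_extremalQuotient p (J 0)).comp hJ.differentiableOn
    fun _ hz => hJ.mul_norm_lt_one hz

lemma IsRegularInner.exists_norm_extremal_le {J : ℂ → ℂ} (hJ : IsRegularInner J) (p : ℝ) :
    ∃ B : ℝ, 0 ≤ B ∧ ∀ z ∈ disk, ‖extremal p J z‖ ≤ B := by
  have hsub : Metric.closedBall (0 : ℂ) 1 ⊆ {w | ‖J 0‖ * ‖w‖ < 1} := fun w hw => by
    have h1 : ‖w‖ ≤ 1 := by simpa using hw
    have := hJ.norm_zero_lt_one
    simp only [mem_ofPred_eq]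
    nlinarith [norm_nonneg (J 0), norm_nonneg w]
  obtain ⟨B, hB⟩ := (isCompact_closedBall (0 : ℂ) 1).exists_bound_of_continuousOn
    ((differentiableOn_extremalQuotient p (J 0)).continuousOn.mono hsub)
  refine ⟨max B 0, le_max_right _ _, fun z hz => (hB (J z) ?_).trans (le_max_left _ _)⟩
  simpa using hJ.norm_le_one z hz

lemma IsRegularInner.memHp_extremal {J : ℂ → ℂ} (hJ : IsRegularInner J) {p : ℝ} (hp : 0 < p) :
    MemHp p (extremal p J) := by
  obtain ⟨B, hB, h⟩ := hJ.exists_norm_extremal_le p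
  exact memHp_of_norm_le (hJ.differentiableOn_extremal p) hp hB h

lemma norm_one_sub_mul_extremal_rpow {p : ℝ} (hp : 0 < p) (J : ℂ → ℂ) (z : ℂ) :
    ‖1 - J z * extremal p J z‖ ^ p = ‖1 - conj (J 0) * J z‖ ^ 2 := by
  rw [one_sub_mul_extremal, Complex.norm_cpow_real, ← Real.rpow_mul (norm_nonneg _),
    div_mul_cancel₀ _ hp.ne', Real.rpow_two]

lemma norm_one_sub_sq (c w : ℂ) :
    ‖1 - conj c * w‖ ^ 2 = 1 + ‖c‖ ^ 2 * ‖w‖ ^ 2 + -2 * (conj c * w).re := by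
  rw [Complex.sq_norm, Complex.sq_norm, Complex.sq_norm, Complex.normSq_sub, Complex.normSq_mul,
    Complex.normSq_conj]
  simp
  ring

lemma circleAverage_const_add_re {J : ℂ → ℂ} (hJ : DifferentiableOn ℂ J disk) {r : ℝ}
    (hr : r ∈ Ioo (0 : ℝ) 1) (b : ℝ) :
    circleAverage (fun z => b + -2 * (conj (J 0) * J z).re) 0 r = b - 2 * ‖J 0‖ ^ 2 := by
  have h1 : DifferentiableOn ℂ (fun z => conj (J 0) * J z) disk := hJ.const_mul _
  have h2 : ContinuousOn (fun z => (conj (J 0) * J z).re) disk :=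
    Complex.continuous_re.comp_continuousOn h1.continuousOn
  rw [circleAverage_add_disk (f := fun _ => b) (g := fun z => -2 * (conj (J 0) * J z).re)
      continuousOn_const (continuousOn_const.mul h2) hr, circleAverage_const_mul, circleAverage_re_eq h1 hr, circleAverage_const,
    ← Complex.normSq_eq_conj_mul_self, Complex.ofReal_re, Complex.normSq_eq_norm_sq]
  ring

/-- As `‖J‖ ≤ 1`, `‖F‖ ^ 2` is at most `1 + ‖c‖ ^ 2 - 2 Re (conj c * J)`, whose mean is `1 - ‖c‖ ^
2` by the mean value property. -/
lemma IsRegularInner.hpNorm_one_sub_extremal_le {J : ℂ → ℂ} (hJ : IsRegularInner J) {p : ℝ}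
    (hp : 0 < p) :
    hpNorm p (1 - J * extremal p J) ≤ ENNReal.ofReal ((1 - ‖J 0‖ ^ 2) ^ (1 / p)) := by
  have hd : DifferentiableOn ℂ (1 - J * extremal p J) disk :=
    (hJ.differentiableOn.mul (hJ.differentiableOn_extremal p)).const_sub 1
  have hc := hJ.norm_zero_lt_one
  rw [hpNorm_le_iff hd.continuousOn hp (by nlinarith [norm_nonneg (J 0)])]
  intro r hr
  have h2 : ContinuousOn (fun z => (conj (J 0) * J z).re) disk :=
    Complex.continuous_re.comp_continuousOn (continuousOn_const.mul hJ.differentiableOn.continuousOn)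
  calc _ ≤ circleAverage (fun z => (1 + ‖J 0‖ ^ 2) + -2 * (conj (J 0) * J z).re) 0 r := by
        refine circleAverage_mono_disk (continuousOn_norm_rpow hd.continuousOn hp.le)
          (continuousOn_const.add (continuousOn_const.mul h2)) hr fun z hz _ => ?_
        have h3 : ‖(1 - J * extremal p J) z‖ ^ p = ‖1 - conj (J 0) * J z‖ ^ 2 :=
          norm_one_sub_mul_extremal_rpow hp J z
        change _ ≤ (1 + ‖J 0‖ ^ 2) + -2 * (conj (J 0) * J z).re
        rw [h3, norm_one_sub_sq]
        have := hJ.norm_le_one z hz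
        have : ‖J z‖ ^ 2 ≤ 1 := pow_le_one₀ (norm_nonneg _) this
        nlinarith [sq_nonneg ‖J 0‖]
    _ = _ := by rw [circleAverage_const_add_re hJ.differentiableOn hr]; ring

/-! ### The lower bound for the means of `‖1 - J g‖ ^ p` -/

lemma norm_rpow_expansion {p : ℝ} {G v : ℂ} (hG : G ≠ 0) :
    ‖G + v‖ ^ p = ‖G‖ ^ p * (1 + p * (v / G).re + remainder p (1 + v / G)) := by
  have : G + v = G * (1 + v / G) := by field_simp
  rw [this, norm_mul, Real.mul_rpow (norm_nonneg _) (norm_nonneg _), remainder,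
    add_sub_cancel_left]
  ring

/-- The pointwise inequality behind the extremal problem: `F = 1 - conj c * j` and `‖G‖ ^ p = ‖F‖ ^ 2`. -/
lemma le_norm_add_rpow {p : ℝ} (hp : 0 < p) {c j u G : ℂ} (hc : ‖c‖ ≤ 1) (hj : ‖j‖ ≤ 1)
    (hG : G ≠ 0) (hF : ‖G‖ ^ p = ‖1 - conj c * j‖ ^ 2) :
    (1 + ‖c‖ ^ 2 + -2 * (conj c * j).re) + p * ((j - c) * ((1 - conj c * j) / G) * u).re
      + ‖1 - conj c * j‖ ^ 2 * remainder p (1 + j * u / G)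
      ≤ ‖G + j * u‖ ^ p + (1 - ‖j‖ ^ 2) * (1 + p * ‖(1 - conj c * j) / G‖ * ‖u‖) := by
  have hj2 : ‖j‖ ^ 2 ≤ 1 := pow_le_one₀ (norm_nonneg _) hj
  have hc2 : ‖c‖ ^ 2 ≤ 1 := pow_le_one₀ (norm_nonneg _) hc
  set F := 1 - conj c * j with hFdef
  -- The boundary identity `conj F * j = j - c` with its exact defect inside the disk.
  have e1 : conj F * j = (j - c) + c * ((1 - ‖j‖ ^ 2 : ℝ) : ℂ) := by
    have : conj j * j = ((‖j‖ ^ 2 : ℝ) : ℂ) := by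
      rw [← Complex.normSq_eq_conj_mul_self, Complex.normSq_eq_norm_sq]
    rw [hFdef, Complex.ofReal_sub, ← this]
    simp
    ring
  have e2 : ‖F‖ ^ 2 * (j * u / G).re =
      ((j - c) * (F / G) * u).re + (1 - ‖j‖ ^ 2) * (c * (F / G) * u).re := by
    rw [← Complex.re_ofReal_mul, ← Complex.re_ofReal_mul, ← Complex.add_re]
    congr 1
    rw [← Complex.normSq_eq_norm_sq, Complex.normSq_eq_conj_mul_self]
    calc conj F * F * (j * u / G) = (conj F * j) * (F / G) * u := by ring
      _ = _ := by rw [e1]; ring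
  have e3 : -(‖F / G‖ * ‖u‖) ≤ (c * (F / G) * u).re := by
    have h1 := neg_le_of_abs_le (Complex.abs_re_le_norm (c * (F / G) * u))
    rw [norm_mul, norm_mul] at h1
    have h2 : ‖c‖ * ‖F / G‖ * ‖u‖ ≤ 1 * ‖F / G‖ * ‖u‖ := by gcongr
    linarith
  have e4 : (1 - ‖j‖ ^ 2) * -(‖F / G‖ * ‖u‖) ≤ (1 - ‖j‖ ^ 2) * (c * (F / G) * u).re :=
    mul_le_mul_of_nonneg_left e3 (by linarith)
  have e5 : ‖c‖ ^ 2 * (1 - ‖j‖ ^ 2) ≤ 1 * (1 - ‖j‖ ^ 2) :=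
    mul_le_mul_of_nonneg_right hc2 (by linarith)
  have e6 : ‖F‖ ^ 2 = 1 + ‖c‖ ^ 2 * ‖j‖ ^ 2 + -2 * (conj c * j).re := norm_one_sub_sq c j
  rw [norm_rpow_expansion hG, hF]
  have e7 : ‖F‖ ^ 2 * (1 + p * (j * u / G).re + remainder p (1 + j * u / G)) =
      ‖F‖ ^ 2 + p * (‖F‖ ^ 2 * (j * u / G).re) + ‖F‖ ^ 2 * remainder p (1 + j * u / G) := by ring
  rw [e7, e2]
  have e8 := mul_le_mul_of_nonneg_left e4 hp.le
  nlinarith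

lemma IsRegularInner.norm_factor_ge {J : ℂ → ℂ} (hJ : IsRegularInner J) {z : ℂ} (hz : z ∈ disk) :
    1 - ‖J 0‖ ≤ ‖1 - conj (J 0) * J z‖ := by
  have h1 := (re_one_sub_ge (J 0) (J z)).trans (Complex.re_le_norm _)
  have h2 := mul_le_mul_of_nonneg_left (hJ.norm_le_one z hz) (norm_nonneg (J 0))
  linarith

lemma IsRegularInner.norm_factor_le {J : ℂ → ℂ} (hJ : IsRegularInner J) {z : ℂ} (hz : z ∈ disk) :
    ‖1 - conj (J 0) * J z‖ ≤ 2 := by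
  have h1 := norm_sub_le 1 (conj (J 0) * J z)
  rw [norm_mul, RCLike.norm_conj, norm_one] at h1
  linarith [hJ.mul_norm_lt_one hz]

lemma norm_one_sub_mul_extremal (p : ℝ) (J : ℂ → ℂ) (z : ℂ) :
    ‖1 - J z * extremal p J z‖ = ‖1 - conj (J 0) * J z‖ ^ (2 / p) := by
  rw [one_sub_mul_extremal, Complex.norm_cpow_real]

lemma IsRegularInner.norm_one_sub_mul_extremal_ge {J : ℂ → ℂ} (hJ : IsRegularInner J) {p : ℝ}
    (hp : 0 < p) {z : ℂ} (hz : z ∈ disk) :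
    (1 - ‖J 0‖) ^ (2 / p) ≤ ‖1 - J z * extremal p J z‖ := by
  rw [norm_one_sub_mul_extremal]
  exact Real.rpow_le_rpow (by linarith [hJ.norm_zero_lt_one]) (hJ.norm_factor_ge hz) (by positivity)

lemma IsRegularInner.norm_one_sub_mul_extremal_le {J : ℂ → ℂ} (hJ : IsRegularInner J) {p : ℝ}
    (hp : 0 < p) {z : ℂ} (hz : z ∈ disk) :
    ‖1 - J z * extremal p J z‖ ≤ 2 ^ (2 / p) := by
  rw [norm_one_sub_mul_extremal]
  exact Real.rpow_le_rpow (norm_nonneg _) (hJ.norm_factor_le hz) (by positivity)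

lemma IsRegularInner.one_sub_mul_extremal_ne_zero {J : ℂ → ℂ} (hJ : IsRegularInner J) {p : ℝ}
    (hp : 0 < p) {z : ℂ} (hz : z ∈ disk) : 1 - J z * extremal p J z ≠ 0 := by
  rw [← norm_pos_iff]
  exact (Real.rpow_pos_of_pos (by linarith [hJ.norm_zero_lt_one]) _).trans_le
    (hJ.norm_one_sub_mul_extremal_ge hp hz)

lemma le_one_add_rpow {p x : ℝ} (hp : 1 ≤ p) (hx : 0 ≤ x) : x ≤ 1 + x ^ p := by
  rcases le_total x 1 with h | h
  · linarith [Real.rpow_nonneg hx p]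
  · linarith [Real.self_le_rpow_of_one_le h hp]

/-- The relative remainder of `1 - J g` with respect to the extremal function. -/
noncomputable def gap (p : ℝ) (J g : ℂ → ℂ) (z : ℂ) : ℝ :=
  ‖1 - conj (J 0) * J z‖ ^ 2 * remainder p ((1 - J z * g z) / (1 - J z * extremal p J z))

lemma IsRegularInner.continuousOn_gap {J g : ℂ → ℂ} (hJ : IsRegularInner J)
    (hg : ContinuousOn g disk) {p : ℝ} (hp : 0 < p) : ContinuousOn (gap p J g) disk := by
  have hJc := hJ.differentiableOn.continuousOn
  have h1 : ContinuousOn (fun z => (1 - J z * g z) / (1 - J z * extremal p J z)) disk :=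
    (continuousOn_const.sub (hJc.mul hg)).div
      (continuousOn_const.sub (hJc.mul (hJ.differentiableOn_extremal p).continuousOn))
      fun z hz => hJ.one_sub_mul_extremal_ne_zero hp hz
  exact ((continuousOn_const.sub (continuousOn_const.mul hJc)).norm.pow 2).mul
    ((continuous_remainder hp.le).comp_continuousOn h1)

lemma IsRegularInner.exists_pointwise_bound {J g : ℂ → ℂ} (hJ : IsRegularInner J) {p : ℝ}
    (hp : 1 < p) :
    ∃ K : ℝ, 0 ≤ K ∧ ∀ z ∈ disk,
      (1 + ‖J 0‖ ^ 2 + -2 * (conj (J 0) * J z).re)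
        + (p * ((J z - J 0) * ((1 - conj (J 0) * J z) / (1 - J z * extremal p J z))
            * (extremal p J z - g z)).re + gap p J g z)
      ≤ ‖1 - J z * g z‖ ^ p + K * (1 - ‖z‖ ^ 2) * (1 + ‖g z‖ ^ p) := by
  have hp0 : 0 < p := by linarith
  obtain ⟨C, hC0, hC⟩ := hJ.defect
  obtain ⟨B, hB0, hB⟩ := hJ.exists_norm_extremal_le p
  have hc := hJ.norm_zero_lt_one
  set m := (1 - ‖J 0‖) ^ (2 / p)
  have hm : 0 < m := Real.rpow_pos_of_pos (by linarith) _
  -- `C` comes from the defect of `J`, `2 / m` bounds `‖F / G‖`, and `B + 1` comes from `‖h* - g‖ ≤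
  -- B + 1 + ‖g‖ ^ p`.
  refine ⟨C * (1 + p * (2 / m) * (B + 1)), by positivity, fun z hz => ?_⟩
  have hG := hJ.one_sub_mul_extremal_ne_zero hp0 hz
  have h := le_norm_add_rpow hp0 (c := J 0) (j := J z) (u := extremal p J z - g z)
    (G := 1 - J z * extremal p J z) hc.le (hJ.norm_le_one z hz) hG
    (norm_one_sub_mul_extremal_rpow hp0 J z)
  have e1 : 1 + J z * (extremal p J z - g z) / (1 - J z * extremal p J z) =
      (1 - J z * g z) / (1 - J z * extremal p J z) := by field_simp; ring
  have e2 : 1 - J z * extremal p J z + J z * (extremal p J z - g z) = 1 - J z * g z := by ring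
  rw [e1, e2] at h
  have hj2 : 0 ≤ 1 - ‖J z‖ ^ 2 :=
    sub_nonneg.2 (pow_le_one₀ (norm_nonneg _) (hJ.norm_le_one z hz))
  have b1 : ‖(1 - conj (J 0) * J z) / (1 - J z * extremal p J z)‖ ≤ 2 / m := by
    rw [norm_div]
    exact div_le_div₀ zero_le_two (hJ.norm_factor_le hz) hm (hJ.norm_one_sub_mul_extremal_ge hp0 hz)
  have b2 : ‖extremal p J z - g z‖ ≤ B + (1 + ‖g z‖ ^ p) :=
    (norm_sub_le _ _).trans (add_le_add (hB z hz) (le_one_add_rpow hp.le (norm_nonneg _)))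
  have hgp : 0 ≤ ‖g z‖ ^ p := Real.rpow_nonneg (norm_nonneg _) _
  have b3 : 1 + p * ‖(1 - conj (J 0) * J z) / (1 - J z * extremal p J z)‖ *
      ‖extremal p J z - g z‖ ≤ (1 + p * (2 / m) * (B + 1)) * (1 + ‖g z‖ ^ p) := by
    calc _ ≤ 1 + p * (2 / m) * (B + (1 + ‖g z‖ ^ p)) := by gcongr
      _ ≤ _ := by
        have h1 : 0 ≤ p * (2 / m) * B * ‖g z‖ ^ p := by positivity
        nlinarith
  have b4 : (1 - ‖J z‖ ^ 2) * (1 + p * ‖(1 - conj (J 0) * J z) / (1 - J z * extremal p J z)‖ *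
      ‖extremal p J z - g z‖) ≤
      C * (1 + p * (2 / m) * (B + 1)) * (1 - ‖z‖ ^ 2) * (1 + ‖g z‖ ^ p) := by
    calc _ ≤ (C * (1 - ‖z‖ ^ 2)) * ((1 + p * (2 / m) * (B + 1)) * (1 + ‖g z‖ ^ p)) :=
          mul_le_mul (hC z hz) b3 (by positivity) (hj2.trans (hC z hz))
      _ = _ := by ring
  unfold gap
  linarith

lemma IsRegularInner.exists_circleAverage_bound {J g : ℂ → ℂ} (hJ : IsRegularInner J) {p : ℝ}
    (hp : 1 < p) (hg : MemHp p g) :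
    ∃ K : ℝ, 0 ≤ K ∧ ∀ r ∈ Ioo (0 : ℝ) 1,
      1 - ‖J 0‖ ^ 2 + circleAverage (gap p J g) 0 r
        ≤ circleAverage (fun z => ‖1 - J z * g z‖ ^ p) 0 r + K * (1 - r ^ 2) := by
  have hp0 : 0 < p := by linarith
  obtain ⟨K, hK0, hK⟩ := hJ.exists_pointwise_bound (g := g) hp
  obtain ⟨B, hB0, hB⟩ := exists_circleAverage_le hg.1.continuousOn hp0 hg.2
  refine ⟨K * (1 + B), by positivity, fun r hr => ?_⟩
  set H : ℂ → ℂ := fun z => (J z - J 0) *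
    ((1 - conj (J 0) * J z) / (1 - J z * extremal p J z)) * (extremal p J z - g z) with hH
  have hJd := hJ.differentiableOn
  have hHd : DifferentiableOn ℂ H disk :=
    ((hJd.sub_const _).mul (((hJd.const_mul _).const_sub 1).div
      ((hJd.mul (hJ.differentiableOn_extremal p)).const_sub 1)
      fun z hz => hJ.one_sub_mul_extremal_ne_zero hp0 hz)).mul
      ((hJ.differentiableOn_extremal p).sub hg.1)
  -- The factor `J z - J 0` kills the first-order term: the mean of `Re H` is `Re (H 0) = 0`.
  have hH0 : H 0 = 0 := by simp [hH]
  have c1 : ContinuousOn (fun z => 1 + ‖J 0‖ ^ 2 + -2 * (conj (J 0) * J z).re) disk :=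
    continuousOn_const.add (continuousOn_const.mul
      (Complex.continuous_re.comp_continuousOn (continuousOn_const.mul hJd.continuousOn)))
  have c2 : ContinuousOn (fun z => p * (H z).re) disk :=
    continuousOn_const.mul (Complex.continuous_re.comp_continuousOn hHd.continuousOn)
  have c3 := hJ.continuousOn_gap hg.1.continuousOn hp0
  have c4 : ContinuousOn (fun z => ‖1 - J z * g z‖ ^ p) disk :=
    continuousOn_norm_rpow (continuousOn_const.sub (hJd.continuousOn.mul hg.1.continuousOn)) hp0.le
  have c5 : ContinuousOn (fun z => 1 + ‖g z‖ ^ p) disk :=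
    continuousOn_const.add (continuousOn_norm_rpow hg.1.continuousOn hp0.le)
  have c6 : ContinuousOn (fun z => K * (1 - r ^ 2) * (1 + ‖g z‖ ^ p)) disk :=
    continuousOn_const.mul c5
  have main := circleAverage_mono_disk (c1.add (c2.add c3)) (c4.add c6) hr fun z hz hzr => by
    have := hK z hz
    rw [hzr] at this
    exact this
  have e1 := circleAverage_add_disk c1 (c2.add c3) hr
  have e2 := circleAverage_add_disk c2 c3 hr
  have e3 := circleAverage_add_disk c4 c6 hr
  have e4 := circleAverage_add_disk (f := fun _ => (1 : ℝ)) continuousOn_const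
    (continuousOn_norm_rpow hg.1.continuousOn hp0.le) hr
  rw [circleAverage_const] at e4
  have e5 := circleAverage_const_mul (K * (1 - r ^ 2)) (fun z => 1 + ‖g z‖ ^ p) r
  have e6 := circleAverage_const_mul p (fun z => (H z).re) r
  rw [circleAverage_re_eq hHd hr, hH0, Complex.zero_re, mul_zero] at e6
  have e7 := circleAverage_const_add_re hJd hr (1 + ‖J 0‖ ^ 2)
  have hr2 : 0 ≤ K * (1 - r ^ 2) :=
    mul_nonneg hK0 (by nlinarith [hr.1, hr.2])
  have e8 := mul_le_mul_of_nonneg_left (hB r hr) hr2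
  change circleAverage (fun z => (1 + ‖J 0‖ ^ 2 + -2 * (conj (J 0) * J z).re) +
    (p * (H z).re + gap p J g z)) 0 r ≤ circleAverage (fun z => ‖1 - J z * g z‖ ^ p +
    K * (1 - r ^ 2) * (1 + ‖g z‖ ^ p)) 0 r at main
  change circleAverage (fun z => (1 + ‖J 0‖ ^ 2 + -2 * (conj (J 0) * J z).re) +
    (p * (H z).re + gap p J g z)) 0 r = _ + circleAverage (fun z => p * (H z).re + gap p J g z) 0 r
    at e1
  rw [e1, e2, e3, e5, e4, e6, e7] at main
  linarith

lemma gap_nonneg {p : ℝ} (hp : 1 < p) (J g : ℂ → ℂ) (z : ℂ) : 0 ≤ gap p J g z :=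
  mul_nonneg (sq_nonneg _) (remainder_nonneg hp _)

lemma circleAverage_gap_nonneg {p : ℝ} (hp : 1 < p) (J g : ℂ → ℂ) (r : ℝ) :
    0 ≤ circleAverage (gap p J g) 0 r :=
  circleAverage_nonneg_of_nonneg fun _ _ => gap_nonneg hp J g _

lemma le_of_forall_le_add_mul_one_sub_sq {x y K : ℝ}
    (h : ∀ r ∈ Ioo (0 : ℝ) 1, x ≤ y + K * (1 - r ^ 2)) : x ≤ y := by
  have hc : ContinuousWithinAt (fun r : ℝ => y + K * (1 - r ^ 2)) (Ioo 0 1) 1 := by fun_prop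
  have : (nhdsWithin (1 : ℝ) (Ioo 0 1)).NeBot :=
    mem_closure_iff_nhdsWithin_neBot.1 (by rw [closure_Ioo zero_ne_one]; simp)
  have := ge_of_tendsto hc (Filter.eventually_of_mem self_mem_nhdsWithin h)
  simpa using this

lemma IsRegularInner.le_hpNorm_one_sub {J g : ℂ → ℂ} (hJ : IsRegularInner J) {p : ℝ}
    (hp : 1 < p) (hg : MemHp p g) :
    ENNReal.ofReal ((1 - ‖J 0‖ ^ 2) ^ (1 / p)) ≤ hpNorm p (1 - J * g) := by
  have hp0 : 0 < p := by linarith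
  have hcont : ContinuousOn (1 - J * g) disk :=
    continuousOn_const.sub (hJ.differentiableOn.continuousOn.mul hg.1.continuousOn)
  by_cases htop : hpNorm p (1 - J * g) = ∞
  · rw [htop]; exact le_top
  have hc := hJ.norm_zero_lt_one
  obtain ⟨K, hK0, hK⟩ := hJ.exists_circleAverage_bound hp hg
  have e : hpNorm p (1 - J * g) =
      ENNReal.ofReal (((hpNorm p (1 - J * g)).toReal ^ p) ^ (1 / p)) := by
    rw [← Real.rpow_mul ENNReal.toReal_nonneg, mul_one_div_cancel hp0.ne', Real.rpow_one,
      ENNReal.ofReal_toReal htop]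
  have hB := (hpNorm_le_iff hcont hp0 (Real.rpow_nonneg ENNReal.toReal_nonneg p)).1 e.le
  rw [e]
  refine ENNReal.ofReal_le_ofReal (Real.rpow_le_rpow (by nlinarith [norm_nonneg (J 0)]) ?_
    (by positivity))
  refine le_of_forall_le_add_mul_one_sub_sq (K := K) fun r hr => ?_
  have h1 := hK r hr
  have h2 := hB r hr
  change circleAverage (fun z => ‖1 - J z * g z‖ ^ p) 0 r ≤ _ at h2
  linarith [circleAverage_gap_nonneg hp J g r]

lemma IsRegularInner.hpNorm_one_sub_extremal {J : ℂ → ℂ} (hJ : IsRegularInner J) {p : ℝ}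
    (hp : 1 < p) :
    hpNorm p (1 - J * extremal p J) = ENNReal.ofReal ((1 - ‖J 0‖ ^ 2) ^ (1 / p)) :=
  le_antisymm (hJ.hpNorm_one_sub_extremal_le (by linarith))
    (hJ.le_hpNorm_one_sub hp (hJ.memHp_extremal (by linarith)))

lemma IsRegularInner.iInf_hpNorm {J : ℂ → ℂ} (hJ : IsRegularInner J) {p : ℝ} (hp : 1 < p) :
    ⨅ (g : ℂ → ℂ) (_ : MemHp p g), hpNorm p (1 - J * g) =
      ENNReal.ofReal ((1 - ‖J 0‖ ^ 2) ^ (1 / p)) := by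
  refine le_antisymm ?_ (le_iInf₂ fun g hg => hJ.le_hpNorm_one_sub hp hg)
  rw [← hJ.hpNorm_one_sub_extremal hp]
  exact iInf₂_le (extremal p J) (hJ.memHp_extremal (by linarith))

lemma IsRegularInner.isExtremal_extremal {J : ℂ → ℂ} (hJ : IsRegularInner J) {p : ℝ}
    (hp : 1 < p) : IsExtremal p J (extremal p J) :=
  ⟨hJ.memHp_extremal (by linarith), by rw [hJ.hpNorm_one_sub_extremal hp, hJ.iInf_hpNorm hp]⟩

/-! ### Uniqueness -/

/-- For an extremal `g` the means of `‖1 - J g‖ ^ p` do not exceed `1 - ‖J 0‖ ^ 2`, which leaves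
only the error term for the gap. -/
lemma IsRegularInner.circleAverage_gap_le {J g : ℂ → ℂ} (hJ : IsRegularInner J) {p : ℝ}
    (hp : 1 < p) (hg : IsExtremal p J g) :
    ∃ K : ℝ, 0 ≤ K ∧ ∀ r ∈ Ioo (0 : ℝ) 1, circleAverage (gap p J g) 0 r ≤ K * (1 - r ^ 2) := by
  obtain ⟨K, hK0, hK⟩ := hJ.exists_circleAverage_bound hp hg.1
  have hc := hJ.norm_zero_lt_one
  have hcont : ContinuousOn (1 - J * g) disk :=
    continuousOn_const.sub (hJ.differentiableOn.continuousOn.mul hg.1.1.continuousOn)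
  have h1 := hg.2
  rw [hJ.iInf_hpNorm hp] at h1
  have h2 := (hpNorm_le_iff hcont (by linarith) (by nlinarith [norm_nonneg (J 0)])).1 h1.le
  refine ⟨K, hK0, fun r hr => ?_⟩
  have h3 := h2 r hr
  change circleAverage (fun z => ‖1 - J z * g z‖ ^ p) 0 r ≤ _ at h3
  linarith [hK r hr]

lemma IsRegularInner.exists_circleAverage_mul_sub_le {J g : ℂ → ℂ} (hJ : IsRegularInner J) {p : ℝ}
    (hp : 1 < p) (hg : IsExtremal p J g) {ε : ℝ} (hε : 0 < ε) :
    ∃ K : ℝ, ∀ r ∈ Ioo (0 : ℝ) 1,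
      circleAverage (fun z => ‖J z * (extremal p J z - g z)‖) 0 r ≤ ε + K * (1 - r ^ 2) := by
  have hp0 : 0 < p := by linarith
  have hc := hJ.norm_zero_lt_one
  have hM : (0 : ℝ) < 2 ^ (2 / p) := by positivity
  obtain ⟨C, hC0, hC⟩ := exists_norm_sub_one_le hp (ε := ε / 2 ^ (2 / p)) (by positivity)
  obtain ⟨K, hK0, hK⟩ := hJ.circleAverage_gap_le hp hg
  -- With `x = (1 - J g) / G`, `J (h* - g) = G (x - 1)`. Here `‖G‖ ≤ 2 ^ (2 / p)`, and dividing by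
  -- `(1 - ‖J 0‖) ^ 2 ≤ ‖F‖ ^ 2` turns the remainder into the gap.
  set L : ℝ := 2 ^ (2 / p) * C / (1 - ‖J 0‖) ^ 2
  have hL : 0 ≤ L := by positivity
  refine ⟨L * K, fun r hr => ?_⟩
  have c1 : ContinuousOn (fun z => ‖J z * (extremal p J z - g z)‖) disk :=
    (hJ.differentiableOn.continuousOn.mul
      ((hJ.differentiableOn_extremal p).continuousOn.sub hg.1.1.continuousOn)).norm
  have c2 := hJ.continuousOn_gap hg.1.1.continuousOn hp0
  have c3 : ContinuousOn (fun z => L * gap p J g z) disk := continuousOn_const.mul c2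
  have main := circleAverage_mono_disk (g := fun z => ε + L * gap p J g z) c1
    (continuousOn_const.add c3) hr fun z hz _ => by
      have hG := hJ.one_sub_mul_extremal_ne_zero hp0 hz
      set x := (1 - J z * g z) / (1 - J z * extremal p J z) with hx
      have e1 : J z * (extremal p J z - g z) = (1 - J z * extremal p J z) * (x - 1) := by
        rw [hx]; field_simp; ring
      have hR := remainder_nonneg hp x
      have hF : (1 - ‖J 0‖) ^ 2 ≤ ‖1 - conj (J 0) * J z‖ ^ 2 :=
        pow_le_pow_left₀ (by linarith) (hJ.norm_factor_ge hz) 2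
      have hpos : 0 < (1 - ‖J 0‖) ^ 2 := pow_pos (by linarith) 2
      rw [e1, norm_mul]
      calc _ ≤ 2 ^ (2 / p) * (ε / 2 ^ (2 / p) + C * remainder p x) :=
            mul_le_mul (hJ.norm_one_sub_mul_extremal_le hp0 hz) (hC x) (norm_nonneg _) hM.le
        _ = ε + L * ((1 - ‖J 0‖) ^ 2 * remainder p x) := by
            rw [← mul_assoc, div_mul_cancel₀ _ hpos.ne', mul_add, mul_div_cancel₀ _ hM.ne', mul_assoc]
        _ ≤ ε + L * (‖1 - conj (J 0) * J z‖ ^ 2 * remainder p x) := by gcongr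
        _ = _ := rfl
  rw [circleAverage_add_disk continuousOn_const c3 hr, circleAverage_const,
    circleAverage_const_mul] at main
  have := mul_le_mul_of_nonneg_left (hK r hr) hL
  linarith

lemma IsRegularInner.eqOn_extremal {J g : ℂ → ℂ} (hJ : IsRegularInner J) {p : ℝ}
    (hp : 1 < p) (hg : IsExtremal p J g) : EqOn g (extremal p J) disk := by
  intro w hw
  rw [mem_disk] at hw
  obtain ⟨C, hC0, hC⟩ := hJ.defect
  set u : ℂ → ℂ := fun z => extremal p J z - g z with hu
  have hud : DifferentiableOn ℂ u disk := (hJ.differentiableOn_extremal p).sub hg.1.1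
  have hJu : ContinuousOn (fun z => ‖J z * u z‖) disk :=
    (hJ.differentiableOn.continuousOn.mul hud.continuousOn).norm
  -- near the boundary `‖J‖ ≥ 1/2`, and the mean of `‖J u‖` is small there
  have key : ∀ ε > 0, (1 - ‖w‖) / 2 * ‖u w‖ ≤ 2 * ε := fun ε hε => by
    obtain ⟨K, hK⟩ := hJ.exists_circleAverage_mul_sub_le hp hg hε
    -- The second condition gives `r - ‖w‖ ≥ (1 - ‖w‖) / 2`; the third gives `‖J‖ ^ 2 > 1 / 2` on
    -- the circle.
    have hT : ∀ᶠ r in nhdsWithin (1 : ℝ) (Iio 1),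
        r ∈ Ioo (0 : ℝ) 1 ∧ (1 + ‖w‖) / 2 < r ∧ C * (1 - r ^ 2) < 1 / 2 := by
      have t1 : Filter.Tendsto (fun r : ℝ => C * (1 - r ^ 2)) (nhdsWithin (1 : ℝ) (Iio 1))
          (nhds (C * (1 - 1 ^ 2))) :=
        (Continuous.tendsto (by fun_prop) (1 : ℝ)).mono_left nhdsWithin_le_nhds
      filter_upwards [Ioo_mem_nhdsLT (show (0 : ℝ) < 1 by norm_num),
        Ioo_mem_nhdsLT (show (1 + ‖w‖) / 2 < 1 by linarith),
        t1.eventually_lt_const (by norm_num : C * (1 - 1 ^ 2) < 1 / 2)] with r h1 h2 h3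
      exact ⟨h1, h2.1, h3⟩
    have hlim : Filter.Tendsto (fun r : ℝ => 2 * (ε + K * (1 - r ^ 2)))
        (nhdsWithin (1 : ℝ) (Iio 1)) (nhds (2 * (ε + K * (1 - 1 ^ 2)))) :=
      (Continuous.tendsto (by fun_prop) (1 : ℝ)).mono_left nhdsWithin_le_nhds
    have hle : ∀ᶠ r in nhdsWithin (1 : ℝ) (Iio 1),
        (1 - ‖w‖) / 2 * ‖u w‖ ≤ 2 * (ε + K * (1 - r ^ 2)) := by
      filter_upwards [hT] with r ⟨hr, hwr, hCr⟩
      have h1 := norm_apply_le_circleAverage hud hr (w := w) (by linarith)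
      have h2 : circleAverage (fun z => ‖u z‖) 0 r ≤
          circleAverage (fun z => 2 * ‖J z * u z‖) 0 r := by
        refine circleAverage_mono_disk hud.continuousOn.norm (continuousOn_const.mul hJu) hr
          fun z hz hzr => ?_
        have h3 := hC z hz
        rw [hzr] at h3
        have h4 := hJ.norm_le_one z hz
        have h5 : 1 / 2 ≤ ‖J z‖ := by nlinarith [norm_nonneg (J z)]
        change ‖u z‖ ≤ 2 * ‖J z * u z‖
        rw [norm_mul]
        nlinarith [norm_nonneg (u z)]
      rw [circleAverage_const_mul] at h2
      have h6 := hK r hr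
      have h7 : 0 < r - ‖w‖ := by linarith
      rw [inv_mul_eq_div, le_div_iff₀ h7] at h1
      have h8 : (1 - ‖w‖) / 2 * ‖u w‖ ≤ ‖u w‖ * (r - ‖w‖) := by
        nlinarith [norm_nonneg (u w)]
      have h9 : circleAverage (fun z => ‖J z * u z‖) 0 r ≤ ε + K * (1 - r ^ 2) := h6
      linarith
    have := ge_of_tendsto hlim hle
    simpa using this
  have h0 : (1 - ‖w‖) / 2 * ‖u w‖ ≤ 0 := by
    refine le_of_forall_pos_le_add fun ε hε => ?_
    have := key (ε / 2) (by positivity)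
    linarith
  have h1 : ‖u w‖ ≤ 0 := by
    by_contra h
    push Not at h
    have : 0 < (1 - ‖w‖) / 2 * ‖u w‖ := mul_pos (by linarith) h
    linarith
  exact (sub_eq_zero.1 (norm_le_zero_iff.1 h1)).symm

/-! ### The distance to the invariant subspace -/

lemma exists_polynomial_approx {f : ℂ → ℂ} {R : ℝ} (hR : 1 < R)
    (hf : DifferentiableOn ℂ f (Metric.closedBall 0 R)) {ε : ℝ} (hε : 0 < ε) :
    ∃ q : Polynomial ℂ, ∀ z ∈ disk, ‖f z - q.eval z‖ ≤ ε := by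
  lift R to NNReal using by linarith
  have hR' : (1 : NNReal) < R := by exact_mod_cast hR
  have hs := hf.hasFPowerSeriesOnBall (zero_lt_one.trans hR')
  have hu := hs.tendstoUniformlyOn (r' := 1) (by exact_mod_cast hR')
  obtain ⟨n, hn⟩ := (Metric.tendstoUniformlyOn_iff.1 hu ε hε).exists
  refine ⟨∑ k ∈ Finset.range n, Polynomial.C ((cauchyPowerSeries f 0 R).coeff k) * Polynomial.X ^ k,
    fun z hz => ?_⟩
  have h1 := hn z (by simpa [disk] using hz)
  rw [dist_eq_norm, zero_add] at h1
  refine le_of_eq_of_le ?_ h1.le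
  congr 2
  rw [Polynomial.eval_finsetSum, FormalMultilinearSeries.partialSum]
  refine Finset.sum_congr rfl fun k _ => ?_
  rw [FormalMultilinearSeries.apply_eq_pow_smul_coeff, Polynomial.eval_C_mul, Polynomial.eval_pow,
    Polynomial.eval_X, smul_eq_mul, mul_comm]

lemma iterate_shift (f : ℂ → ℂ) (k : ℕ) : shift^[k] f = fun z => z ^ k * f z := by
  induction k with
  | zero => ext z; simp
  | succ k ih =>
    rw [Function.iterate_succ_apply', ih]
    ext z
    simp only [shift]
    ring

lemma mem_span_shift_iff {f u : ℂ → ℂ} :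
    u ∈ Submodule.span ℂ (range fun k : ℕ => shift^[k] f) ↔
      ∃ q : Polynomial ℂ, u = fun z => q.eval z * f z := by
  constructor
  · intro h
    induction h using Submodule.span_induction with
    | mem x hx =>
      obtain ⟨k, rfl⟩ := hx
      exact ⟨Polynomial.X ^ k, by simp [iterate_shift]⟩
    | zero => exact ⟨0, by ext; simp⟩
    | add x y _ _ hx hy =>
      obtain ⟨q, rfl⟩ := hx
      obtain ⟨q', rfl⟩ := hy
      exact ⟨q + q', by ext; simp [add_mul]⟩
    | smul b x _ hx =>
      obtain ⟨q, rfl⟩ := hx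
      exact ⟨Polynomial.C b * q, by ext; simp [mul_assoc]⟩
  · rintro ⟨q, rfl⟩
    have : (fun z => q.eval z * f z) = ∑ k ∈ Finset.range (q.natDegree + 1), q.coeff k • shift^[k] f := by
      ext z
      simp [iterate_shift, Polynomial.eval_eq_sum_range, Finset.sum_mul, mul_assoc]
    rw [this]
    exact Submodule.sum_mem _ fun k _ =>
      Submodule.smul_mem _ _ (Submodule.subset_span ⟨k, rfl⟩)

lemma exists_norm_eval_le (q : Polynomial ℂ) : ∃ B : ℝ, 0 ≤ B ∧ ∀ z ∈ disk, ‖q.eval z‖ ≤ B := by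
  obtain ⟨B, hB⟩ := (isCompact_closedBall (0 : ℂ) 1).exists_bound_of_continuousOn
    (f := fun z => q.eval z) q.continuous.continuousOn
  exact ⟨max B 0, le_max_right _ _,
    fun z hz => (hB z (Metric.ball_subset_closedBall hz)).trans (le_max_left _ _)⟩

/-- Elements of the span are `q J` with `q` a polynomial, hence in `H^p`, so the extremal bound
applies to them and passes to the closure. -/
lemma IsRegularInner.le_hpDist {J : ℂ → ℂ} (hJ : IsRegularInner J) {p : ℝ} (hp : 1 < p) :
    ENNReal.ofReal ((1 - ‖J 0‖ ^ 2) ^ (1 / p)) ≤ hpDist p 1 (invariantSubspace p J) := by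
  refine le_iInf₂ fun g hg => ENNReal.le_of_forall_pos_le_add fun ε hε _ => ?_
  obtain ⟨u, hu, hgu⟩ := hg.2 ε (by exact_mod_cast hε)
  obtain ⟨q, rfl⟩ := mem_span_shift_iff.1 hu
  obtain ⟨B, hB0, hB⟩ := exists_norm_eval_le q
  have hq : DifferentiableOn ℂ (fun z => q.eval z) disk := q.differentiable.differentiableOn
  have hJd := hJ.differentiableOn
  have h1 := hJ.le_hpNorm_one_sub hp (memHp_of_norm_le hq (by linarith) hB0 hB)
  have e : 1 - J * (fun z => q.eval z) = (1 - g) + (g - fun z => q.eval z * J z) := by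
    ext z
    simp only [Pi.sub_apply, Pi.add_apply, Pi.mul_apply, Pi.one_apply]
    ring
  rw [e] at h1
  refine h1.trans ((hpNorm_add_le ?_ ?_ hp.le).trans (add_le_add le_rfl hgu.le))
  · exact continuousOn_const.sub hg.1.1.continuousOn
  · exact hg.1.1.continuousOn.sub (hq.mul hJd).continuousOn

lemma IsRegularInner.mul_extremal_mem {J : ℂ → ℂ} (hJ : IsRegularInner J) {p : ℝ} (hp : 0 < p)
    {R : ℝ} (hR : 1 < R) (hd : DifferentiableOn ℂ (extremal p J) (Metric.closedBall 0 R)) :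
    J * extremal p J ∈ invariantSubspace p J := by
  obtain ⟨B, hB0, hB⟩ := hJ.exists_norm_extremal_le p
  have hJd := hJ.differentiableOn
  refine ⟨memHp_of_norm_le (hJd.mul (hJ.differentiableOn_extremal p)) hp hB0 fun z hz => ?_,
    fun ε hε => ?_⟩
  · rw [Pi.mul_apply, norm_mul]
    calc _ ≤ 1 * B := mul_le_mul (hJ.norm_le_one z hz) (hB z hz) (norm_nonneg _) zero_le_one
      _ = B := one_mul B
  · obtain ⟨δ, hδ0, hδ⟩ := ENNReal.lt_iff_exists_nnreal_btwn.1 hε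
    have hδ0' : (0 : ℝ) < δ := by exact_mod_cast hδ0
    obtain ⟨q, hq⟩ := exists_polynomial_approx hR hd hδ0'
    refine ⟨_, mem_span_shift_iff.2 ⟨q, rfl⟩, lt_of_le_of_lt ?_ hδ⟩
    rw [← ENNReal.ofReal_coe_nnreal]
    have hqd : DifferentiableOn ℂ (fun z => q.eval z) disk := q.differentiable.differentiableOn
    refine hpNorm_le_of_norm_le ?_ hp hδ0'.le fun z hz => ?_
    · exact ((hJd.mul (hJ.differentiableOn_extremal p)).sub (hqd.mul hJd)).continuousOn
    · simp only [Pi.sub_apply, Pi.mul_apply]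
      rw [mul_comm (q.eval z), ← mul_sub, norm_mul]
      calc _ ≤ 1 * (δ : ℝ) := mul_le_mul (hJ.norm_le_one z hz) (hq z hz) (norm_nonneg _) zero_le_one
        _ = δ := one_mul _

lemma IsRegularInner.hpDist_eq {J : ℂ → ℂ} (hJ : IsRegularInner J) {p : ℝ} (hp : 1 < p)
    {R : ℝ} (hR : 1 < R) (hd : DifferentiableOn ℂ (extremal p J) (Metric.closedBall 0 R)) :
    hpDist p 1 (invariantSubspace p J) = ENNReal.ofReal ((1 - ‖J 0‖ ^ 2) ^ (1 / p)) := by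
  refine le_antisymm ?_ (hJ.le_hpDist hp)
  rw [← hJ.hpNorm_one_sub_extremal hp]
  exact iInf₂_le _ (hJ.mul_extremal_mem (by linarith) hR hd)

/-! ### Finite Blaschke products -/

lemma one_sub_conj_mul_ne_zero {a z : ℂ} (h : ‖a‖ * ‖z‖ < 1) : 1 - conj a * z ≠ 0 :=
  Complex.slitPlane_ne_zero (one_sub_mem_slitPlane h)

lemma mul_norm_lt_one_of_le {a z : ℂ} (ha : ‖a‖ < 1) (hz : ‖z‖ ≤ 1) : ‖a‖ * ‖z‖ < 1 := by
  nlinarith [norm_nonneg a, norm_nonneg z]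

lemma one_sub_norm_blaschkeFactor_sq {a z : ℂ} (h : ‖a‖ * ‖z‖ < 1) :
    1 - ‖(z - a) / (1 - conj a * z)‖ ^ 2 =
      (1 - ‖a‖ ^ 2) * (1 - ‖z‖ ^ 2) / ‖1 - conj a * z‖ ^ 2 := by
  have h1 : ‖1 - conj a * z‖ ^ 2 ≠ 0 := pow_ne_zero 2 (norm_ne_zero_iff.2 (one_sub_conj_mul_ne_zero h))
  rw [norm_div, div_pow, eq_div_iff h1, sub_mul, div_mul_cancel₀ _ h1, one_mul, norm_one_sub_sq,
    Complex.sq_norm (z - a), Complex.normSq_sub, Complex.sq_norm, Complex.sq_norm, mul_comm z]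
  ring

lemma norm_blaschkeFactor_le_one {a z : ℂ} (ha : ‖a‖ < 1) (hz : ‖z‖ ≤ 1) :
    ‖(z - a) / (1 - conj a * z)‖ ≤ 1 := by
  have h1 := one_sub_norm_blaschkeFactor_sq (mul_norm_lt_one_of_le ha hz)
  have h2 : 0 ≤ (1 - ‖a‖ ^ 2) * (1 - ‖z‖ ^ 2) / ‖1 - conj a * z‖ ^ 2 := by
    have : ‖a‖ ^ 2 ≤ 1 := pow_le_one₀ (norm_nonneg _) ha.le
    have : ‖z‖ ^ 2 ≤ 1 := pow_le_one₀ (norm_nonneg _) hz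
    exact div_nonneg (mul_nonneg (by linarith) (by linarith)) (sq_nonneg _)
  nlinarith [norm_nonneg ((z - a) / (1 - conj a * z))]

lemma one_sub_norm_blaschkeFactor_sq_le {a z : ℂ} (ha : ‖a‖ < 1) (hz : ‖z‖ ≤ 1) :
    1 - ‖(z - a) / (1 - conj a * z)‖ ^ 2 ≤ ((1 - ‖a‖) ^ 2)⁻¹ * (1 - ‖z‖ ^ 2) := by
  have hz2 : ‖z‖ ^ 2 ≤ 1 := pow_le_one₀ (norm_nonneg _) hz
  have h1 : 1 - ‖a‖ ≤ ‖1 - conj a * z‖ := by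
    have := (re_one_sub_ge a z).trans (Complex.re_le_norm _)
    nlinarith [norm_nonneg a]
  have h2 : 0 < 1 - ‖a‖ := by linarith
  rw [one_sub_norm_blaschkeFactor_sq (mul_norm_lt_one_of_le ha hz), inv_mul_eq_div]
  refine div_le_div₀ (by linarith) ?_ (by positivity) (pow_le_pow_left₀ h2.le h1 2)
  nlinarith [sq_nonneg ‖a‖]

/-- Reduces the defect of a Blaschke product to those of its factors. -/
lemma one_sub_prod_le_sum {ι : Type*} (s : Finset ι) (x : ι → ℝ) (h0 : ∀ i, 0 ≤ x i)
    (h1 : ∀ i, x i ≤ 1) : 1 - ∏ i ∈ s, x i ≤ ∑ i ∈ s, (1 - x i) := by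
  classical
  induction s using Finset.induction_on with
  | empty => simp
  | insert i s hi ih =>
    rw [Finset.prod_insert hi, Finset.sum_insert hi]
    have h2 : ∏ i ∈ s, x i ≤ 1 := Finset.prod_le_one (fun i _ => h0 i) fun i _ => h1 i
    nlinarith [h0 i, h1 i]

lemma norm_blaschke_le_one {N : ℕ} {a : Fin N → ℂ} (ha : ∀ k, ‖a k‖ < 1) {z : ℂ} (hz : ‖z‖ ≤ 1) :
    ‖blaschke a z‖ ≤ 1 := by
  rw [blaschke, norm_prod]
  exact Finset.prod_le_one (fun _ _ => norm_nonneg _) fun k _ =>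
    norm_blaschkeFactor_le_one (ha k) hz

lemma differentiableAt_blaschke {N : ℕ} {a : Fin N → ℂ} {z : ℂ} (h : ∀ k, ‖a k‖ * ‖z‖ < 1) :
    DifferentiableAt ℂ (blaschke a) z := by
  unfold blaschke
  refine DifferentiableAt.fun_finsetProd fun k _ => ?_
  exact DifferentiableAt.div (by fun_prop) (by fun_prop) (one_sub_conj_mul_ne_zero (h k))

lemma blaschke_zero {N : ℕ} (a : Fin N → ℂ) : blaschke a 0 = ∏ k, -a k := by simp [blaschke]

lemma norm_blaschke_zero {N : ℕ} (a : Fin N → ℂ) : ‖blaschke a 0‖ = ‖∏ k, a k‖ := by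
  simp [blaschke_zero]

lemma norm_blaschke_zero_lt_one {N : ℕ} (hN : 1 ≤ N) {a : Fin N → ℂ} (ha : ∀ k, ‖a k‖ < 1) :
    ‖blaschke a 0‖ < 1 := by
  rw [norm_blaschke_zero, norm_prod, ← Finset.mul_prod_erase _ _ (Finset.mem_univ ⟨0, hN⟩)]
  have h1 : ∏ k ∈ Finset.univ.erase (⟨0, hN⟩ : Fin N), ‖a k‖ ≤ 1 :=
    Finset.prod_le_one (fun _ _ => norm_nonneg _) fun k _ => (ha k).le
  have h2 := ha ⟨0, hN⟩
  nlinarith [norm_nonneg (a ⟨0, hN⟩)]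

lemma isRegularInner_blaschke {N : ℕ} (hN : 1 ≤ N) {a : Fin N → ℂ} (ha : ∀ k, ‖a k‖ < 1) :
    IsRegularInner (blaschke a) where
  differentiableOn z hz := (differentiableAt_blaschke fun k =>
    mul_norm_lt_one_of_le (ha k) (mem_disk.1 hz).le).differentiableWithinAt
  norm_le_one z hz := norm_blaschke_le_one ha (mem_disk.1 hz).le
  norm_zero_lt_one := norm_blaschke_zero_lt_one hN ha
  defect := by
    refine ⟨∑ k, ((1 - ‖a k‖) ^ 2)⁻¹, by positivity, fun z hz => ?_⟩
    have hz1 := (mem_disk.1 hz).le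
    rw [blaschke, norm_prod, ← Finset.prod_pow, Finset.sum_mul]
    refine (one_sub_prod_le_sum _ _ (fun k => by positivity) fun k => ?_).trans
      (Finset.sum_le_sum fun k _ => one_sub_norm_blaschkeFactor_sq_le (ha k) hz1)
    exact pow_le_one₀ (norm_nonneg _) (norm_blaschkeFactor_le_one (ha k) hz1)

lemma exists_differentiableOn_extremal_blaschke {N : ℕ} (hN : 1 ≤ N) {a : Fin N → ℂ}
    (ha : ∀ k, ‖a k‖ < 1) (p : ℝ) :
    ∃ R : ℝ, 1 < R ∧ DifferentiableOn ℂ (extremal p (blaschke a)) (Metric.closedBall 0 R) := by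
  set V : Set ℂ := {z | ∀ k, ‖a k‖ * ‖z‖ < 1} with hV
  have hVo : IsOpen V := by
    rw [hV, ofPred_forall]
    exact isOpen_iInter_of_finite fun k => isOpen_lt (by fun_prop) (by fun_prop)
  have hd : DifferentiableOn ℂ (blaschke a) V := fun z hz =>
    (differentiableAt_blaschke hz).differentiableWithinAt
  have hWo : IsOpen {w : ℂ | ‖blaschke a 0‖ * ‖w‖ < 1} := isOpen_lt (by fun_prop) (by fun_prop)
  have hU := hd.continuousOn.isOpen_inter_preimage hVo hWo
  -- The open set where `J` is holomorphic and `‖J 0‖ * ‖J z‖ < 1` contains the compact closed disk,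
  -- hence a closed disk of radius `1 + δ`.
  obtain ⟨δ, hδ, hsub⟩ := (isCompact_closedBall (0 : ℂ) 1).exists_cthickening_subset_open hU
    fun z hz => by
      have hz1 : ‖z‖ ≤ 1 := by simpa using hz
      exact ⟨fun k => mul_norm_lt_one_of_le (ha k) hz1,
        mul_norm_lt_one_of_le (norm_blaschke_zero_lt_one hN ha) (norm_blaschke_le_one ha hz1)⟩
  rw [cthickening_closedBall hδ.le zero_le_one] at hsub
  exact ⟨δ + 1, by linarith, (differentiableOn_extremalQuotient p (blaschke a 0)).comp
    (hd.mono fun z hz => (hsub hz).1) fun z hz => (hsub hz).2⟩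

/-! ### Factorization of the extremal function -/

open Polynomial in
lemma one_sub_C_mul_X_eq {b : ℂ} (hb : b ≠ 0) :
    (1 - C b * X : ℂ[X]) = C (-b) * (X - C b⁻¹) := by
  rw [mul_sub, ← C_mul, neg_mul, mul_inv_cancel₀ hb]
  simp
  ring

open Polynomial in
lemma prod_one_sub_C_mul_X_eq {ι : Type*} (s : Finset ι) {b : ι → ℂ} (hb : ∀ i, b i ≠ 0) :
    (∏ i ∈ s, (1 - C (b i) * X) : ℂ[X]) = C (∏ i ∈ s, -b i) * ∏ i ∈ s, (X - C (b i)⁻¹) := by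
  rw [map_prod, ← Finset.prod_mul_distrib]
  exact Finset.prod_congr rfl fun i _ => one_sub_C_mul_X_eq (hb i)

open Polynomial in
-- No root is `0`, so each `X - root` is a multiple of `1 - X / root`; evaluation at `0` fixes the
-- constant.
lemma exists_factorization {Q : ℂ[X]} (hQ : Q.eval 0 ≠ 0) :
    ∃ w : Fin Q.natDegree → ℂ, (∀ k, w k ≠ 0 ∧ Q.eval (conj (w k))⁻¹ = 0) ∧
      Q = C (Q.eval 0) * ∏ k, (1 - C (conj (w k)) * X) := by
  have hQ0 : Q ≠ 0 := fun h => hQ (by simp [h])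
  have hcard : Q.roots.toList.length = Q.natDegree := by
    rw [Multiset.length_toList, ← splits_iff_card_roots.1 (IsAlgClosed.splits Q)]
  rw [← hcard]
  set l := Q.roots.toList with hl
  have hroot : ∀ k : Fin l.length, Q.eval l[k.1] = 0 := fun k => by
    have h1 : l[k.1] ∈ Q.roots := Multiset.mem_toList.1 (List.getElem_mem _)
    exact (mem_roots hQ0).1 h1
  have hne : ∀ k : Fin l.length, l[k.1] ≠ 0 := fun k h => hQ (h ▸ hroot k)
  have hprod : Q = C Q.leadingCoeff * ∏ k : Fin l.length, (X - C l[k.1]) := by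
    rw [Fin.prod_univ_fun_getElem l (fun x => X - C x)]
    conv_lhs => rw [(IsAlgClosed.splits Q).eq_prod_roots]
    rw [hl, ← Multiset.prod_coe, ← Multiset.map_coe, Multiset.coe_toList]
  have hfac : Q = C (Q.leadingCoeff * (∏ k : Fin l.length, -(l[k.1])⁻¹)⁻¹) *
      ∏ k : Fin l.length, (1 - C (l[k.1])⁻¹ * X) := by
    rw [prod_one_sub_C_mul_X_eq _ fun k => inv_ne_zero (hne k), ← mul_assoc, ← C_mul,
      inv_mul_cancel_right₀ (Finset.prod_ne_zero_iff.2 fun k _ =>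
        neg_ne_zero.2 (inv_ne_zero (hne k)))]
    simpa using hprod
  have heval : Q.eval 0 = Q.leadingCoeff * (∏ k : Fin l.length, -(l[k.1])⁻¹)⁻¹ := by
    conv_lhs => rw [hfac]
    simp [eval_prod]
  refine ⟨fun k => conj (l[k.1])⁻¹, fun k => ⟨?_, ?_⟩, ?_⟩
  · simpa using hne k
  · simpa using hroot k
  · rw [heval]
    simpa using hfac

/-- Equal multiplicities mean equinumerous fibres, and bijections of fibres glue. -/
lemma exists_equiv_of_map_univ_eq {α β γ : Type*} [Fintype α] [Fintype β] {f : α → γ} {g : β → γ}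
    (h : (Finset.univ : Finset α).val.map f = (Finset.univ : Finset β).val.map g) :
    ∃ e : α ≃ β, f = g ∘ e := by
  classical
  have hc : ∀ c, Nonempty ({a // f a = c} ≃ {b // g b = c}) := fun c => by
    rw [← Fintype.card_eq, Fintype.card_subtype, Fintype.card_subtype]
    have := congrArg (Multiset.count c) h
    rw [Multiset.count_map, Multiset.count_map] at this
    simp only [eq_comm (a := c)] at this
    exact this
  exact ⟨Equiv.ofFiberEquiv fun c => (hc c).some,
    funext fun a => (Equiv.ofFiberEquiv_map _ a).symm⟩

open Polynomial in
lemma exists_equiv_of_prod_eq {d d' : ℕ} {w : Fin d → ℂ} {w' : Fin d' → ℂ} (hw : ∀ k, w k ≠ 0)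
    (hw' : ∀ k, w' k ≠ 0)
    (h : (∏ k, (1 - C (conj (w' k)) * X) : ℂ[X]) = ∏ k, (1 - C (conj (w k)) * X)) :
    ∃ e : Fin d' ≃ Fin d, w' = w ∘ e := by
  have hr : ∀ {n : ℕ} (v : Fin n → ℂ), (∀ k, v k ≠ 0) →
      (∏ k, (1 - C (conj (v k)) * X) : ℂ[X]).roots =
        (Finset.univ : Finset (Fin n)).val.map fun k => (conj (v k))⁻¹ := fun {n} v hv => by
    have hv' : ∀ k, conj (v k) ≠ 0 := fun k => by simpa using hv k
    rw [prod_one_sub_C_mul_X_eq _ hv', roots_C_mul _ (Finset.prod_ne_zero_iff.2 fun k _ =>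
      neg_ne_zero.2 (hv' k)), roots_prod _ _ (Finset.prod_ne_zero_iff.2 fun k _ => X_sub_C_ne_zero _)]
    simp [Multiset.bind_singleton]
  have h1 := congrArg roots h
  rw [hr w' hw', hr w hw] at h1
  obtain ⟨e, he⟩ := exists_equiv_of_map_univ_eq h1
  refine ⟨e, funext fun k => ?_⟩
  have h2 := congrFun he k
  exact (starRingEnd ℂ).injective (inv_injective h2)

open Polynomial in
/-- The numerator `∏ (1 - conj a_k X) - conj (J 0) ∏ (X - a_k)` of `1 - conj (J 0) J`. -/
noncomputable def numerator {N : ℕ} (a : Fin N → ℂ) : ℂ[X] :=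
  ∏ k, (1 - C (conj (a k)) * X) - C (conj (blaschke a 0)) * ∏ k, (X - C (a k))

lemma eval_numerator {N : ℕ} (a : Fin N → ℂ) (z : ℂ) :
    (numerator a).eval z =
      ∏ k, (1 - conj (a k) * z) - conj (blaschke a 0) * ∏ k, (z - a k) := by
  simp [numerator, Polynomial.eval_prod]

lemma eval_zero_numerator {N : ℕ} (a : Fin N → ℂ) : (numerator a).eval 0 = (scale a : ℂ) := by
  have h : ∏ k, ((0 : ℂ) - a k) = blaschke a 0 := by simp [blaschke_zero]
  rw [eval_numerator, h, ← Complex.normSq_eq_conj_mul_self, Complex.normSq_eq_norm_sq, scale,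
    norm_blaschke_zero]
  simp

lemma numerator_div_eq {N : ℕ} {a : Fin N → ℂ} {z : ℂ} (h : ∀ k, 1 - conj (a k) * z ≠ 0) :
    (numerator a).eval z / ∏ k, (1 - conj (a k) * z) = 1 - conj (blaschke a 0) * blaschke a z := by
  have h1 : ∏ k, (1 - conj (a k) * z) ≠ 0 := Finset.prod_ne_zero_iff.2 fun k _ => h k
  have h2 : blaschke a z = (∏ k, (z - a k)) / ∏ k, (1 - conj (a k) * z) := by
    rw [blaschke, Finset.prod_div_distrib]
  rw [eval_numerator, h2, sub_div, div_self h1, mul_div_assoc]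

open Polynomial in
-- As no `a k` is `0`, both products have degree `N`. The first has leading coefficient `∏ -conj (a
-- k) = conj (J 0)`, so the top terms cancel.
lemma degree_numerator_lt {N : ℕ} {a : Fin N → ℂ} (ha : ∀ k, a k ≠ 0) :
    (numerator a).degree < N := by
  have h1 : conj (blaschke a 0) = ∏ k, -conj (a k) := by simp [blaschke_zero]
  have hm : ∀ b : Fin N → ℂ, (∏ k, (X - C (b k)) : ℂ[X]).Monic := fun b =>
    monic_prod_of_monic _ _ fun k _ => monic_X_sub_C _
  have hd : ∀ b : Fin N → ℂ, (∏ k, (X - C (b k)) : ℂ[X]).degree = N := fun b => by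
    simp [degree_prod]
  rw [numerator, prod_one_sub_C_mul_X_eq _ (fun k => by simpa using ha k), h1, ← mul_sub]
  rw [degree_C_mul (Finset.prod_ne_zero_iff.2 fun k _ => by simpa using ha k)]
  have := degree_sub_lt_left ((hd fun k => (conj (a k))⁻¹).trans (hd a).symm) (hm _).ne_zero
    ((hm _).leadingCoeff.trans (hm _).leadingCoeff.symm)
  rwa [hd] at this

lemma scale_pos {N : ℕ} (hN : 1 ≤ N) {a : Fin N → ℂ} (ha : ∀ k, ‖a k‖ < 1) : 0 < scale a := by
  have := norm_blaschke_zero_lt_one hN ha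
  rw [norm_blaschke_zero] at this
  rw [scale]
  nlinarith [norm_nonneg (∏ k, a k)]

lemma blaschke_apply_self {N : ℕ} (a : Fin N → ℂ) (j : Fin N) : blaschke a (a j) = 0 :=
  Finset.prod_eq_zero (Finset.mem_univ j) (by simp)

lemma exists_factor_eq_scale_mul_ratio {N : ℕ} (hN : 1 ≤ N) {a : Fin N → ℂ}
    (ha : ∀ k, ‖a k‖ < 1) (ha0 : ∀ k, a k ≠ 0) :
    ∃ (d : ℕ) (w : Fin d → ℂ), d ≤ N - 1 ∧ (∀ k, w k ∈ Metric.closedBall (0 : ℂ) 1 \ {0}) ∧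
      ∀ z ∈ disk, 1 - conj (blaschke a 0) * blaschke a z = (scale a : ℂ) * ratio a w z := by
  have hs := scale_pos hN ha
  have hev := eval_zero_numerator a
  have hden : ∀ z ∈ disk, ∀ k, 1 - conj (a k) * z ≠ 0 := fun z hz k =>
    one_sub_conj_mul_ne_zero (mul_norm_lt_one_of_le (ha k) (mem_disk.1 hz).le)
  have hne : (numerator a).eval 0 ≠ 0 := by
    rw [hev]; exact_mod_cast hs.ne'
  obtain ⟨w, hw, hfac⟩ := exists_factorization hne
  refine ⟨_, w, ?_, fun k => ⟨?_, (hw k).1⟩, fun z hz => ?_⟩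
  · have h0 : numerator a ≠ 0 := fun h => hne (by simp [h])
    have := (Polynomial.natDegree_lt_iff_degree_lt h0).2 (degree_numerator_lt ha0)
    omega
  -- If `‖w k‖ > 1`, the root `1 / conj (w k)` lies in the disk, where `1 - conj (J 0) * J` has no
  -- zero.
  · by_contra hk
    have h1 : 1 < ‖w k‖ := by simpa using hk
    have h2 : (conj (w k))⁻¹ ∈ disk := by
      rw [mem_disk, norm_inv, RCLike.norm_conj]
      exact inv_lt_one_of_one_lt₀ h1
    have h3 := numerator_div_eq (hden _ h2)
    rw [(hw k).2, zero_div] at h3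
    exact one_sub_conj_mul_ne_zero ((isRegularInner_blaschke hN ha).mul_norm_lt_one h2) h3.symm
  · rw [← numerator_div_eq (hden z hz), ratio, ← mul_div_assoc]
    congr 1
    conv_lhs => rw [hfac, hev]
    simp [Polynomial.eval_prod]

/-- The two numerators have degree below `N` and agree at `N` distinct nodes, so they coincide;
their roots then recover the parameters. -/
lemma Consistent.exists_equiv {N d d' : ℕ} (hN : 1 ≤ N) {a : Fin N → ℂ} (ha : ∀ k, ‖a k‖ < 1)
    (hinj : Function.Injective a) {w : Fin d → ℂ} {w' : Fin d' → ℂ} (hd : d ≤ N - 1)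
    (hd' : d' ≤ N - 1) (hw : ∀ k, w k ≠ 0) (hw' : ∀ k, w' k ≠ 0) (h : Consistent a w)
    (h' : Consistent a w') : ∃ e : Fin d' ≃ Fin d, w' = w ∘ e := by
  refine exists_equiv_of_prod_eq hw hw' ?_
  have hdeg : ∀ {n : ℕ} (v : Fin n → ℂ), n ≤ N - 1 →
      (∏ k, (1 - Polynomial.C (conj (v k)) * Polynomial.X) : Polynomial ℂ).degree <
        (Finset.univ : Finset (Fin N)).card := fun {n} v hn => by
    rw [Finset.card_fin]
    refine lt_of_le_of_lt (b := ((n : ℕ) : WithBot ℕ)) ?_ (by exact_mod_cast (by omega : n < N))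
    rw [Polynomial.degree_prod]
    refine (Finset.sum_le_sum (g := fun _ => (1 : WithBot ℕ)) fun k _ => ?_).trans (by simp)
    compute_degree
  refine Polynomial.eq_of_degrees_lt_of_eval_index_eq Finset.univ hinj.injOn (hdeg w' hd')
    (hdeg w hd) fun j _ => ?_
  have hs : (scale a : ℂ) ≠ 0 := by exact_mod_cast (scale_pos hN ha).ne'
  have hden : ∏ k, (1 - conj (a k) * a j) ≠ 0 := Finset.prod_ne_zero_iff.2 fun k _ =>
    one_sub_conj_mul_ne_zero (mul_norm_lt_one_of_le (ha k) (ha j).le)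
  have h1 := mul_left_cancel₀ hs ((h' j).symm.trans (h j))
  rw [ratio, ratio, div_left_inj' hden] at h1
  simpa [Polynomial.eval_prod] using h1

lemma ofReal_mul_cpow {s : ℝ} (hs : 0 < s) {x : ℂ} (hx : x ≠ 0) (t : ℝ) :
    ((s : ℂ) * x) ^ (t : ℂ) = ((s ^ t : ℝ) : ℂ) * x ^ (t : ℂ) := by
  have hs' : (s : ℂ) ≠ 0 := by exact_mod_cast hs.ne'
  rw [Complex.ofReal_cpow hs.le, Complex.cpow_def_of_ne_zero (mul_ne_zero hs' hx),
    Complex.log_ofReal_mul hs hx, Complex.ofReal_log hs.le, add_mul, Complex.exp_add,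
    ← Complex.cpow_def_of_ne_zero hs', ← Complex.cpow_def_of_ne_zero hx]

end Hardy

theorem proposition3p1 (p : ℝ) (hp : 1 < p) (N : ℕ) (hN : 1 ≤ N) (a : Fin N → ℂ)
    (ha : ∀ k, a k ∈ Hardy.disk \ {0}) :
    (∃ h : ℂ → ℂ,
      Hardy.IsExtremal p (Hardy.blaschke a) h ∧
      (∀ g : ℂ → ℂ, Hardy.IsExtremal p (Hardy.blaschke a) g → Set.EqOn g h Hardy.disk) ∧
      (∀ z ∈ Hardy.disk, 1 - Hardy.blaschke a z * h z =
        (1 - (starRingEnd ℂ) (Hardy.blaschke a 0) * Hardy.blaschke a z) ^ ((2 / p : ℝ) : ℂ)) ∧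
      (∃ (d : ℕ) (w : Fin d → ℂ), d ≤ N - 1 ∧
        (∀ k, w k ∈ Metric.closedBall (0 : ℂ) 1 \ {0}) ∧
        (∀ z ∈ Hardy.disk, 1 - Hardy.blaschke a z * h z =
          ((Hardy.scale a ^ (2 / p) : ℝ) : ℂ) * Hardy.ratio a w z ^ ((2 / p : ℝ) : ℂ)) ∧
        Hardy.Consistent a w ∧
        (Function.Injective a →
          ∀ (d' : ℕ) (w' : Fin d' → ℂ), d' ≤ N - 1 → (∀ k, w' k ≠ 0) → Hardy.Consistent a w' →
            ∃ e : Fin d' ≃ Fin d, w' = w ∘ e)) ∧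
      (∀ k, N = 1 → ∀ z ∈ Hardy.disk, 1 - Hardy.blaschke a z * h z =
        (((1 - ‖a k‖ ^ 2 : ℝ) : ℂ) / (1 - (starRingEnd ℂ) (a k) * z)) ^ ((2 / p : ℝ) : ℂ))) ∧
    Hardy.hpDist p 1 (Hardy.invariantSubspace p (Hardy.blaschke a)) =
      ENNReal.ofReal ((1 - ‖Hardy.blaschke a 0‖ ^ 2) ^ (1 / p)) := by
  have ha1 : ∀ k, ‖a k‖ < 1 := fun k => Hardy.mem_disk.1 (ha k).1
  have hJ := Hardy.isRegularInner_blaschke hN ha1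
  obtain ⟨R, hR, hd⟩ := Hardy.exists_differentiableOn_extremal_blaschke hN ha1 p
  obtain ⟨d, w, hdN, hw, hF⟩ :=
    Hardy.exists_factor_eq_scale_mul_ratio hN ha1 fun k => (ha k).2
  -- At `a j` the Blaschke product vanishes, so `F = 1` there.
  have hcons : Hardy.Consistent a w := fun j => by
    rw [← hF _ (ha j).1, Hardy.blaschke_apply_self, mul_zero, sub_zero]
  refine ⟨⟨Hardy.extremal p (Hardy.blaschke a), hJ.isExtremal_extremal hp,
    fun g hg => hJ.eqOn_extremal hp hg, fun z _ => Hardy.one_sub_mul_extremal p _ z,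
    ⟨d, w, hdN, hw, fun z hz => ?_, hcons, fun hinj d' w' hd' hw' hc' =>
      Hardy.Consistent.exists_equiv hN ha1 hinj hdN hd' (fun k => (hw k).2) hw' hcons hc'⟩,
    fun k hN1 z hz => ?_⟩, hJ.hpDist_eq hp hR hd⟩
  · rw [Hardy.one_sub_mul_extremal, hF z hz]
    refine Hardy.ofReal_mul_cpow (Hardy.scale_pos hN ha1) (fun h0 => ?_) _
    have h1 := hF z hz
    rw [h0, mul_zero] at h1
    exact Hardy.one_sub_conj_mul_ne_zero (hJ.mul_norm_lt_one hz) h1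
  · subst hN1
    obtain rfl : d = 0 := by omega
    obtain rfl : k = 0 := Subsingleton.elim _ _
    rw [Hardy.one_sub_mul_extremal, hF z hz]
    congr 1
    simp [Hardy.scale, Hardy.ratio, div_eq_mul_inv]
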